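/- Let $D\ge 1$ and $\Delta_1,\Delta_2,u\in\mathbb{C}$, and put $s=u+\frac{\Delta_2-\Delta_1}{2}$, $t=u+\frac{\Delta_1-\Delta_2}{2}$; assume $s,t\notin\{-\frac D2-n : n=0,1,2,\dots\}$ (so that $\hat p^{2s}$ and $\hat p^{2t}$ exist). On functions $f(x_1,x_2)$, $x_1,x_2\in\mathbb{R}^D$, let $\hat q_{12}^{2\lambda}$ be multiplication by $|x_1-x_2|^{2\lambda}$, let $(\mathcal{P}_{12}f)(x_1,x_2)=f(x_2,x_1)$, and let $\hat p_k^{2\alpha}$ be the power of $\hat p_k=-i\partial_{x_k}$, that is the operator in the variable $x_k$ with integral kernel $a(-\alpha)|x-y|^{-2(D/2+\alpha)}$, $a(\beta)=\frac{\Gamma(D/2-\beta)}{2^{2\beta}\pi^{D/2}\Gamma(\beta)}$, if $\operatorname{Re}\alpha<0$, and the Fourier multiplier by $|k|^{2\alpha}$ (the analytic continuation in $\alpha$) if $\operatorname{Re}\alpha\ge 0$. Let $$R=R_{\Delta_1\Delta_2}(u)=\mathcal{P}_{12}\,\hat q_{12}^{\,2(u+\frac{D-\Delta_1-\Delta_2}{2})}\,\hat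 p_2^{\,2(u+\frac{\Delta_1-\Delta_2}{2})}\,\hat p_1^{\,2(u+\frac{\Delta_2-\Delta_1}{2})}\,\hat q_{12}^{\,2(u+\frac{\Delta_1+\Delta_2-D}{2})}.$$ The group $O(1,D+1)$ (which contains $SO(1,D+1)$ and the inversion $x\mapsto x/|x|^2$) acts on $\mathbb{R}^D\cup\{\infty\}$ by conformal transformations: $g\,\xi(x)=\Omega_g(x)\,\xi(gx)$, where $\xi(x)=(x,\frac{1-|x|^2}{2},\frac{1+|x|^2}{2})$. It acts on functions of $(x_1,x_2)$ in the representation $\rho=\rho^{\Delta_1}\otimes\rho^{\Delta_2}$ by $$(\rho(g)f)(x_1,x_2)=|\Omega_{g^{-1}}(x_1)|^{-\Delta_1}\,|\Omega_{g^{-1}}(x_2)|^{-\Delta_2}\,f(g^{-1}x_1,g^{-1}x_2).$$ A test function is a smooth function of $(x_1,x_2)$ with compact support contained in $\{x_1\ne x_2\}$. All identities below are at points where the transformations involved are finite, and identities between values of $R$ are at points with $x_1\neq x_2$. The operator $R_{\Delta_1\Delta_2}(u)$ is conformally invariant, i.e. it commutes with $O(1,D+1)$, in particular with $SO(1,D+1)$,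 acting in $\rho^{\Delta_1}\otimes\rho^{\Delta_2}$: (a) if $g\in O(1,D+1)$ and both $f$ and $\rho(g)f$ are test functions, then $R\,\rho(g)f=\rho(g)\,Rf$; (b) if $g_1,\dots,g_n\in O(1,D+1)$ and $f_1,\dots,f_n$ are test functions with $\sum_i\rho(g_i)f_i=0$, then $\sum_i\rho(g_i)Rf_i=0$; that is, $R$ extends to an operator commuting with the whole group on the invariant space spanned by all $\rho(g)f$ with $f$ a test function; (c) if $\operatorname{Re}s<0$ and $\operatorname{Re}t<0$, so that $R$ is an integral operator, then for every $g\in O(1,D+1)$ and every function $f$ such that the integral for $Rf$ converges absolutely at $(g^{-1}x_1,g^{-1}x_2)$, the integral for $R\,\rho(g)f$ converges absolutely at $(x_1,x_2)$, and $(R\,\rho(g)f)(x_1,x_2)=(\rho(g)Rf)(x_1,x_2)$. -/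

import Mathlib

open scoped FourierTransform ContDiff Matrix

noncomputable section

namespace ConformalR

/-- The Euclidean space `ℝ^D`. -/
abbrev Space (D : ℕ) : Type := EuclideanSpace ℝ (Fin D)

/-! ### Powers of the coordinate and momentum operators -/

/-- The normalization `a(α) = Γ(D/2 - α) / (2^{2α} π^{D/2} Γ(α))`. -/
def aCoeff (D : ℕ) (α : ℂ) : ℂ :=
  Complex.Gamma ((D : ℂ) / 2 - α) /
    ((2 : ℂ) ^ (2 * α) * (Real.pi : ℂ) ^ ((D : ℂ) / 2) * Complex.Gamma α)

/-- The operator `p^{2s}` on functions of one variable in `ℝ^D`, where `p = -i∂`.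
For `Re s < 0` it is the integral operator with kernel `a(-s) / |x - y|^{2(D/2 + s)}`, which is
locally integrable.  For `Re s ≥ 0` that kernel is no longer locally integrable (only its analytic
continuation makes sense), and `p^{2s}` is the Fourier multiplier by `|k|^{2s}`; with Mathlib's
normalization `e^{-2πi⟨x, ξ⟩}` of the Fourier transform the momentum is `k = 2πξ`. -/
def pPow {D : ℕ} (s : ℂ) (h : Space D → ℂ) (x : Space D) : ℂ :=
  if s.re < 0 then
    aCoeff D (-s) * ∫ y : Space D, ((‖x - y‖ : ℝ) : ℂ) ^ (-(2 * ((D : ℂ) / 2 + s))) * h y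
  else
    𝓕⁻ (fun ξ : Space D => ((2 * Real.pi * ‖ξ‖ : ℝ) : ℂ) ^ (2 * s) * 𝓕 h ξ) x

/-- `p₁^{2s}`: the operator `p^{2s}` in the first variable. -/
def p1Pow {D : ℕ} (s : ℂ) (f : Space D → Space D → ℂ) : Space D → Space D → ℂ :=
  fun x₁ x₂ => pPow s (fun y => f y x₂) x₁

/-- `p₂^{2s}`: the operator `p^{2s}` in the second variable. -/
def p2Pow {D : ℕ} (s : ℂ) (f : Space D → Space D → ℂ) : Space D → Space D → ℂ :=
  fun x₁ x₂ => pPow s (fun y => f x₁ y) x₂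

/-- `q₁₂^{2l}`: multiplication by `|x₁ - x₂|^{2l}`. -/
def q12Pow {D : ℕ} (l : ℂ) (f : Space D → Space D → ℂ) : Space D → Space D → ℂ :=
  fun x₁ x₂ => ((‖x₁ - x₂‖ : ℝ) : ℂ) ^ (2 * l) * f x₁ x₂

/-- The permutation operator `P₁₂`. -/
def perm {D : ℕ} (f : Space D → Space D → ℂ) : Space D → Space D → ℂ :=
  fun x₁ x₂ => f x₂ x₁

/-- The operator
`R_{Δ₁Δ₂}(u) = P₁₂ q₁₂^{2(u+(D-Δ₁-Δ₂)/2)} p₂^{2(u+(Δ₁-Δ₂)/2)} p₁^{2(u+(Δ₂-Δ₁)/2)}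
q₁₂^{2(u+(Δ₁+Δ₂-D)/2)}`. -/
def ROp {D : ℕ} (Δ₁ Δ₂ u : ℂ) (f : Space D → Space D → ℂ) : Space D → Space D → ℂ :=
  perm (q12Pow (u + ((D : ℂ) - Δ₁ - Δ₂) / 2)
    (p2Pow (u + (Δ₁ - Δ₂) / 2)
      (p1Pow (u + (Δ₂ - Δ₁) / 2)
        (q12Pow (u + (Δ₁ + Δ₂ - (D : ℂ)) / 2) f))))

/-! ### The conformal group and its scalar representations -/

/-- The metric `diag(1, …, 1, -1)` with `D + 1` plus signs. -/
def eta (D : ℕ) : Matrix (Fin D ⊕ Fin 2) (Fin D ⊕ Fin 2) ℝ :=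
  Matrix.diagonal (Sum.elim (fun _ => 1) ![1, -1])

/-- The full pseudo-orthogonal group `O(1, D+1)`, which contains `SO(1, D+1)` (the elements of
determinant one) and also the inversion `x ↦ x / |x|²`, which has determinant `-1`. -/
def conformalGroup (D : ℕ) : Subgroup (GL (Fin D ⊕ Fin 2) ℝ) where
  carrier := {g | (g.1)ᵀ * eta D * g.1 = eta D}
  one_mem' := by simp
  mul_mem' := by
    intro a b ha hb
    simp only [Set.mem_ofPred_eq] at ha hb ⊢
    calc ((a * b).1)ᵀ * eta D * (a * b).1
        = (b.1)ᵀ * ((a.1)ᵀ * eta D * a.1) * b.1 := by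
          simp [Matrix.transpose_mul, Matrix.mul_assoc]
      _ = eta D := by rw [ha, hb]
  inv_mem' := by
    intro a ha
    simp only [Set.mem_ofPred_eq] at ha ⊢
    have h1 : a.1 * (a⁻¹).1 = 1 := a.mul_inv
    have h2 : ((a⁻¹).1)ᵀ * (a.1)ᵀ = 1 := by
      rw [← Matrix.transpose_mul, h1, Matrix.transpose_one]
    calc ((a⁻¹).1)ᵀ * eta D * (a⁻¹).1
        = ((a⁻¹).1)ᵀ * ((a.1)ᵀ * eta D * a.1) * (a⁻¹).1 := by rw [ha]
      _ = (((a⁻¹).1)ᵀ * (a.1)ᵀ) * eta D * (a.1 * (a⁻¹).1) := by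
          simp only [Matrix.mul_assoc]
      _ = eta D := by rw [h1, h2, Matrix.one_mul, Matrix.mul_one]

/-- The light-cone embedding `x ↦ (x, (1 - |x|²)/2, (1 + |x|²)/2)` of `ℝ^D`. -/
def lift {D : ℕ} (x : Space D) : Fin D ⊕ Fin 2 → ℝ :=
  Sum.elim (fun i => x i) ![(1 - ‖x‖ ^ 2) / 2, (1 + ‖x‖ ^ 2) / 2]

/-- The number `Ω_g(x)` in `g · lift x = Ω_g(x) • lift (g x)`.  It vanishes exactly at the points
that the conformal transformation `g` sends to infinity. -/
def factor {D : ℕ} (g : GL (Fin D ⊕ Fin 2) ℝ) (x : Space D) : ℝ :=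
  (g.1 *ᵥ lift x) (Sum.inr 0) + (g.1 *ᵥ lift x) (Sum.inr 1)

/-- The conformal transformation `x ↦ g x` of `ℝ^D` (meaningful where `factor g x ≠ 0`). -/
def act {D : ℕ} (g : GL (Fin D ⊕ Fin 2) ℝ) (x : Space D) : Space D :=
  WithLp.toLp 2 (fun i => (factor g x)⁻¹ * (g.1 *ᵥ lift x) (Sum.inl i))

/-- The action of `g` on pairs of scalar fields of dimensions `Δ₁`, `Δ₂`, that is
`ρ^{Δ₁} ⊗ ρ^{Δ₂}`:
`f ↦ |Ω_{g⁻¹}(x₁)|^{-Δ₁} |Ω_{g⁻¹}(x₂)|^{-Δ₂} f(g⁻¹ x₁, g⁻¹ x₂)`.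
The Jacobian determinant of `g⁻¹` at `x` has absolute value `|Ω_{g⁻¹}(x)|^{-D}`; for the inversion
`Ω(x) = |x|²`. -/
def rho {D : ℕ} (Δ₁ Δ₂ : ℂ) (g : GL (Fin D ⊕ Fin 2) ℝ) (f : Space D → Space D → ℂ) :
    Space D → Space D → ℂ :=
  fun x₁ x₂ => ((|factor g⁻¹ x₁| : ℝ) : ℂ) ^ (-Δ₁) * ((|factor g⁻¹ x₂| : ℝ) : ℂ) ^ (-Δ₂) *
    f (act g⁻¹ x₁) (act g⁻¹ x₂)

/-! ### Functions on which the operators act -/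

/-- Smooth functions of `(x₁, x₂)` with compact support off the diagonal `x₁ = x₂`. -/
structure IsTest {D : ℕ} (f : Space D → Space D → ℂ) : Prop where
  smooth : ContDiff ℝ ∞ (fun z : Space D × Space D => f z.1 z.2)
  compact : HasCompactSupport (fun z : Space D × Space D => f z.1 z.2)
  off_diag : ∀ z ∈ tsupport (fun z : Space D × Space D => f z.1 z.2), z.1 ≠ z.2

/-- For `Re (u + (Δ₂ - Δ₁)/2) < 0` and `Re (u + (Δ₁ - Δ₂)/2) < 0` the operator `R_{Δ₁Δ₂}(u)` is an
integral operator.  This says that the integral for its value on `f` at `(x₁, x₂)` converges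
absolutely. -/
def Converges {D : ℕ} (Δ₁ Δ₂ u : ℂ) (f : Space D → Space D → ℂ) (x₁ x₂ : Space D) : Prop :=
  MeasureTheory.Integrable (fun y : Space D × Space D =>
    ((‖x₂ - y.1‖ : ℝ) : ℂ) ^ (-(2 * ((D : ℂ) / 2 + (u + (Δ₂ - Δ₁) / 2)))) *
    ((‖x₁ - y.2‖ : ℝ) : ℂ) ^ (-(2 * ((D : ℂ) / 2 + (u + (Δ₁ - Δ₂) / 2)))) *
    (((‖y.1 - y.2‖ : ℝ) : ℂ) ^ (2 * (u + (Δ₁ + Δ₂ - (D : ℂ)) / 2)) * f y.1 y.2))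

end ConformalR

end

/-! Write `s` and `t` for the exponents of `p₁` and `p₂`. If both have negative real part, `R` is an
integral operator whose kernel is a product of powers of `|x₁ - x₂|`, `|x₂ - y₁|`, `|x₁ - y₂|` and
`|y₁ - y₂|`. A conformal map satisfies `Ω(x) Ω(y) |gx - gy|² = |x - y|²` (`norm_act_sub_sq`),
because the squared distance is a Minkowski product of light-cone lifts, and its Jacobian is
`|Ω|^{-D}` (`abs_det_fderiv_act`). Substituting `y ↦ g⁻¹ y` in the integral, the powers of `Ω` at
`y₁`, `y₂`, `x₁`, `x₂` match the weights `Δ₁`, `Δ₂` exactly. This is `converges_and_ROp_rho`; it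
needs only absolute convergence, and summing it gives the statement on relations `∑ ρ(gᵢ) fᵢ = 0` in
this region.

For other `u` such a relation is continued analytically: neither it nor `ρ` involves `u`, and on
test functions `R f` is holomorphic in `u` off the excluded values (`IsTest.differentiableAt_ROp`).
These are countably many, so the remaining domain is connected, and the identity theorem applies
(`sum_rho_ROp_eq_zero`). Commutation on a single test function is the relation `ρ(g) f + ρ(1)(-f') =
0`.

The analytic work lies in the holomorphy, since `p^{2s}` is given by two formulas. The position
kernel is locally integrable for `Re s < 0`, the Fourier multiplier for `Re s > -D/2`. They agree on
the common strip (`riesz_potential_eq`), both being Mellin transforms of Gaussian averages. The two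
half-planes cover `ℂ`, and in each one the integral against a rapidly decaying function holomorphic
in `u` is dominated locally uniformly in `u`. -/

namespace ConformalR

open MeasureTheory Filter Topology

/-! ### Holomorphy of parameter integrals -/

/-- An integral depending holomorphically on a parameter, with a uniform integrable bound, is
holomorphic. -/
theorem differentiableOn_integral_of_dominated {α : Type*} [MeasurableSpace α] {μ : Measure α}
    {F : ℂ → α → ℂ} {U : Set ℂ} {bound : α → ℝ} (hU : IsOpen U)
    (hm : ∀ z ∈ U, AEStronglyMeasurable (F z) μ) (hb : Integrable bound μ)
    (hle : ∀ᵐ a ∂μ, ∀ z ∈ U, ‖F z a‖ ≤ bound a)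
    (hd : ∀ᵐ a ∂μ, DifferentiableOn ℂ (fun z => F z a) U) :
    DifferentiableOn ℂ (fun z => ∫ a, F z a ∂μ) U := by
  intro z₀ hz₀
  obtain ⟨ε, hε, hεU⟩ := Metric.isOpen_iff.1 hU z₀ hz₀
  -- Half the radius, so that closed discs of radius `r` about points of `ball z₀ r` stay in `U`;
  -- Cauchy's estimate on them gives the derivative bound `bound a / r`.
  set r := ε / 2 with hr
  have hr0 : 0 < r := by positivity
  have hsub : ∀ z ∈ Metric.ball z₀ r, Metric.closedBall z r ⊆ U := by
    intro z hz w hw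
    apply hεU
    rw [Metric.mem_ball] at hz ⊢
    rw [Metric.mem_closedBall] at hw
    linarith [dist_triangle w z z₀]
  have hD : ∀ᵐ a ∂μ, ∀ z ∈ Metric.ball z₀ r,
      HasDerivAt (fun z => F z a) (deriv (fun z => F z a) z) z := by
    filter_upwards [hd] with a ha z hz
    have hzU : z ∈ U := hsub z hz (Metric.mem_closedBall_self hr0.le)
    exact (ha.differentiableAt (hU.mem_nhds hzU)).hasDerivAt
  have key := hasDerivAt_integral_of_dominated_loc_of_deriv_le (μ := μ) (F := F)
    (bound := fun a => bound a / r) (F' := fun z a => deriv (fun z => F z a) z)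
    (Metric.ball_mem_nhds z₀ hr0) ?_ ?_ ?_ ?_ (hb.div_const r) hD
  · exact key.2.differentiableAt.differentiableWithinAt
  · filter_upwards [hU.mem_nhds hz₀] with z hz using hm z hz
  · refine hb.mono' (hm z₀ hz₀) ?_
    filter_upwards [hle] with a ha using ha z₀ hz₀
  -- The derivative at `z₀` is measurable in `a` as a limit of difference quotients along a sequence
  -- tending to `z₀` inside `U`.
  · have hseq : Tendsto (fun n : ℕ => z₀ + ((r / 2 * (1 / ((n : ℝ) + 1)) : ℝ) : ℂ)) atTop
        (𝓝[≠] z₀) := by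
      rw [tendsto_nhdsWithin_iff]
      constructor
      · have h1 : Tendsto (fun n : ℕ => (r / 2 * (1 / ((n : ℝ) + 1)) : ℝ)) atTop (𝓝 (r / 2 * 0)) :=
          tendsto_one_div_add_atTop_nhds_zero_nat.const_mul _
        have h2 := (Complex.continuous_ofReal.tendsto _).comp h1
        simpa using h2.const_add z₀
      · refine Eventually.of_forall fun n => ?_
        have h3 : (0 : ℝ) < r / 2 * (1 / ((n : ℝ) + 1)) := by positivity
        simpa using Complex.ofReal_ne_zero.2 h3.ne'
    refine aestronglyMeasurable_of_tendsto_ae atTop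
      (f := fun (n : ℕ) a => slope (fun z => F z a) z₀
        (z₀ + ((r / 2 * (1 / ((n : ℝ) + 1)) : ℝ) : ℂ))) ?_ ?_
    · intro n
      have hmem : z₀ + ((r / 2 * (1 / ((n : ℝ) + 1)) : ℝ) : ℂ) ∈ U := by
        apply hsub z₀ (Metric.mem_ball_self hr0)
        have h3 : (0 : ℝ) ≤ r / 2 * (1 / ((n : ℝ) + 1)) := by positivity
        rw [Metric.mem_closedBall, dist_eq_norm, add_sub_cancel_left, Complex.norm_real,
          Real.norm_of_nonneg h3]
        have : 1 / ((n : ℝ) + 1) ≤ 1 := by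
          rw [div_le_one (by positivity)]
          linarith [n.cast_nonneg (α := ℝ)]
        nlinarith
      simp only [slope_def_field, div_eq_mul_inv]
      exact AEStronglyMeasurable.mul_const (AEStronglyMeasurable.sub (hm _ hmem) (hm _ hz₀)) _
    · filter_upwards [hD] with a ha
      exact (hasDerivAt_iff_tendsto_slope.1 (ha z₀ (Metric.mem_ball_self hr0))).comp hseq
  · filter_upwards [hle, hd] with a ha hda z hz
    refine Complex.norm_deriv_le_of_forall_mem_sphere_norm_le hr0 ?_ fun w hw =>
      ha w (hsub z hz (Metric.sphere_subset_closedBall hw))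
    refine DifferentiableOn.diffContOnCl ?_
    rw [closure_ball z hr0.ne']
    exact hda.mono (hsub z hz)

/-! ### Polynomial weights and integrability of powers of the distance -/

/-- The weight `(1 + |y|²)^{-N}` measuring the decay of functions. -/
noncomputable def weight {D : ℕ} (N : ℕ) (y : Space D) : ℝ := ((1 + ‖y‖ ^ 2) ^ N)⁻¹

lemma weight_pos {D : ℕ} (N : ℕ) (y : Space D) : 0 < weight N y := by
  unfold weight; positivity

@[fun_prop]
lemma continuous_weight {D : ℕ} (N : ℕ) : Continuous (weight N : Space D → ℝ) := by
  unfold weight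
  exact Continuous.inv₀ (by fun_prop) fun y => by positivity

/-- Peetre's inequality `1 + |x - y|² ≤ 2 (1 + |x|²)(1 + |y|²)`. It recentres the weight at the
singularity `x` of the kernel. -/
lemma weight_le_sub {D : ℕ} (N : ℕ) (x y : Space D) :
    weight N y ≤ (2 * (1 + ‖x‖ ^ 2)) ^ N * weight N (x - y) := by
  unfold weight
  rw [← div_eq_mul_inv, le_div_iff₀ (by positivity), inv_mul_le_iff₀ (by positivity), ← mul_pow]
  gcongr
  have h1 : ‖x - y‖ ≤ ‖x‖ + ‖y‖ := norm_sub_le x y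
  have h2 : ‖x - y‖ ^ 2 ≤ (‖x‖ + ‖y‖) ^ 2 := by gcongr
  nlinarith [sq_nonneg (‖x‖ - ‖y‖), sq_nonneg (‖x‖ * ‖y‖)]

/-- In polar coordinates the radial integrand is at most `t^{D-1+r}` on `(0, 1)` and `t^{D-1+r-2N}`
beyond `1`; the two hypotheses are the convergence conditions at the two ends. -/
lemma integrable_norm_rpow_mul_weight {D : ℕ} [NeZero D] {N : ℕ} {r : ℝ} (hr : -(D : ℝ) < r)
    (hN : D + r < 2 * N) : Integrable (fun y : Space D => ‖y‖ ^ r * weight N y) := by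
  have hD : 1 ≤ D := NeZero.one_le
  have hD' : ((D - 1 : ℕ) : ℝ) = D - 1 := by push_cast [hD]; ring
  refine (integrable_fun_norm_addHaar (volume : Measure (Space D))
    (f := fun t : ℝ => t ^ r * ((1 + t ^ 2) ^ N)⁻¹)).2 ?_
  rw [finrank_euclideanSpace_fin]
  have hmeas : Measurable fun y : ℝ => y ^ (D - 1) • (y ^ r * ((1 + y ^ 2) ^ N)⁻¹) := by fun_prop
  have hpow : ∀ y : ℝ, 0 < y → y ^ (D - 1) * y ^ r = y ^ (D - 1 + r) := by
    intro y hy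
    rw [← Real.rpow_natCast, ← Real.rpow_add hy, hD']
  rw [← Set.Ioo_union_Ici_eq_Ioi zero_lt_one]
  refine IntegrableOn.union ?_ (integrableOn_Ici_iff_integrableOn_Ioi (by simp) |>.2 ?_)
  · refine Integrable.mono' ((intervalIntegral.integrableOn_Ioo_rpow_iff zero_lt_one).2
      (show -1 < (D : ℝ) - 1 + r by linarith)) hmeas.aestronglyMeasurable ?_
    refine (ae_restrict_iff' measurableSet_Ioo).2 (Eventually.of_forall fun y hy => ?_)
    have hy0 : 0 < y := hy.1
    rw [smul_eq_mul, ← mul_assoc, hpow y hy0, Real.norm_of_nonneg (by positivity)]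
    refine mul_le_of_le_one_right (by positivity) (inv_le_one_of_one_le₀ (one_le_pow₀ ?_))
    nlinarith
  · refine Integrable.mono' (integrableOn_Ioi_rpow_of_lt
      (show (D : ℝ) - 1 + r - 2 * N < -1 by linarith) zero_lt_one) hmeas.aestronglyMeasurable ?_
    refine (ae_restrict_iff' measurableSet_Ioi).2 (Eventually.of_forall fun y hy => ?_)
    have hy0 : 0 < y := lt_trans zero_lt_one hy
    rw [smul_eq_mul, ← mul_assoc, hpow y hy0, Real.norm_of_nonneg (by positivity),
      Real.rpow_sub hy0, div_eq_mul_inv]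
    gcongr
    rw [show (2 * N : ℝ) = ((2 * N : ℕ) : ℝ) by push_cast; ring, Real.rpow_natCast, pow_mul]
    gcongr
    linarith

lemma integrable_weight {D : ℕ} [NeZero D] {N : ℕ} (hN : D ≤ N) :
    Integrable (weight N : Space D → ℝ) := by
  have h1 : (1 : ℝ) ≤ D := by exact_mod_cast NeZero.one_le
  have h2 : (D : ℝ) ≤ N := by exact_mod_cast hN
  simpa using integrable_norm_rpow_mul_weight (D := D) (N := N) (r := 0) (by linarith) (by linarith)

lemma integrable_norm_sub_rpow_mul_weight {D : ℕ} [NeZero D] {N : ℕ} {r : ℝ} (hr : -(D : ℝ) < r)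
    (hN : D + r < 2 * N) (x : Space D) :
    Integrable (fun y : Space D => ‖x - y‖ ^ r * weight N y) := by
  have h := ((integrable_norm_rpow_mul_weight hr hN).comp_sub_left x).const_mul
    ((2 * (1 + ‖x‖ ^ 2)) ^ N)
  refine h.mono' (Measurable.aestronglyMeasurable (by fun_prop)) (Eventually.of_forall fun y => ?_)
  have := weight_pos N y
  rw [Real.norm_of_nonneg (by positivity), mul_left_comm]
  gcongr
  exact weight_le_sub N x y

/-! ### Agreement of the position and momentum formulas for `p^{2s}` -/

/-- Complex powers of a positive function as a superposition of exponentials. -/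
theorem Gamma_mul_integral_cpow_neg {α : Type*} [MeasurableSpace α] {μ : Measure α} [SFinite μ]
    {a : ℂ} (ha : 0 < a.re) {r : α → ℝ} {φ : α → ℂ} (hr : Measurable r)
    (hr0 : ∀ᵐ y ∂μ, 0 < r y) (hφ : AEStronglyMeasurable φ μ)
    (hint : Integrable (fun y => r y ^ (-a.re) * ‖φ y‖) μ) :
    Complex.Gamma a * ∫ y, (r y : ℂ) ^ (-a) * φ y ∂μ =
      ∫ τ in Set.Ioi (0 : ℝ), (τ : ℂ) ^ (a - 1) *
        ∫ y, Complex.exp (-(r y * τ)) * φ y ∂μ := by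
  have hinv : ∀ x : ℝ, 0 < x → ∀ z : ℂ, (1 / (x : ℂ)) ^ z = (x : ℂ) ^ (-z) := by
    intro x hx z
    rw [one_div, Complex.inv_cpow _ _ (by rw [Complex.arg_ofReal_of_nonneg hx.le]; positivity),
      Complex.cpow_neg]
  have hnorm : ∀ τ : ℝ, 0 < τ → ∀ x : ℝ,
      ‖(τ : ℂ) ^ (a - 1) * Complex.exp (-(x * τ))‖ = τ ^ (a.re - 1) * Real.exp (-(x * τ)) := by
    intro τ hτ x
    rw [norm_mul, Complex.norm_cpow_eq_rpow_re_of_pos hτ, Complex.norm_exp]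
    simp
  have hmeas : AEStronglyMeasurable (fun p : ℝ × α =>
      ((p.1 : ℂ) ^ (a - 1) * Complex.exp (-(r p.2 * p.1))) * φ p.2)
      ((volume.restrict (Set.Ioi (0 : ℝ))).prod μ) := by
    refine AEStronglyMeasurable.mul (Measurable.aestronglyMeasurable ?_) hφ.comp_snd
    fun_prop
  have hI : Integrable (fun p : ℝ × α =>
      ((p.1 : ℂ) ^ (a - 1) * Complex.exp (-(r p.2 * p.1))) * φ p.2)
      ((volume.restrict (Set.Ioi (0 : ℝ))).prod μ) := by
    rw [integrable_prod_iff' hmeas]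
    constructor
    · filter_upwards [hr0] with y hy
      refine Integrable.mul_const ?_ _
      have h := integrableOn_rpow_mul_exp_neg_mul_rpow (p := 1) (s := a.re - 1) (b := r y)
        (by linarith) one_pos hy
      refine Integrable.mono' h (Measurable.aestronglyMeasurable (by fun_prop)) ?_
      refine (ae_restrict_iff' measurableSet_Ioi).2 (Eventually.of_forall fun τ hτ => ?_)
      rw [hnorm τ hτ]
      simp
    -- For fixed `y` the `τ`-integral of the absolute value is `Γ(Re a) r(y)^{-Re a} ‖φ y‖`, so
    -- `hint` is precisely what Fubini requires.
    · refine (hint.const_mul (Real.Gamma a.re)).congr ?_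
      filter_upwards [hr0] with y hy
      simp only [norm_mul _ (φ y)]
      rw [integral_mul_const, setIntegral_congr_fun measurableSet_Ioi
        (fun τ hτ => hnorm τ hτ (r y)), Real.integral_rpow_mul_exp_neg_mul_Ioi ha hy, one_div,
        Real.inv_rpow hy.le, Real.rpow_neg hy.le]
      ring
  have hswap := integral_integral_swap (f := fun (τ : ℝ) (y : α) =>
    ((τ : ℂ) ^ (a - 1) * Complex.exp (-(r y * τ))) * φ y) hI
  calc Complex.Gamma a * ∫ y, (r y : ℂ) ^ (-a) * φ y ∂μ
      = ∫ y, (∫ τ in Set.Ioi (0 : ℝ),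
          ((τ : ℂ) ^ (a - 1) * Complex.exp (-(r y * τ))) * φ y) ∂μ := by
        rw [← integral_const_mul]
        refine integral_congr_ae ?_
        filter_upwards [hr0] with y hy
        rw [integral_mul_const, Complex.integral_cpow_mul_exp_neg_mul_Ioi ha hy, hinv _ hy]
        ring
    _ = _ := by
        rw [← hswap]
        refine integral_congr_ae (Eventually.of_forall fun τ => ?_)
        simp only [mul_assoc, integral_const_mul]

/-- Convolution with a Gaussian, expressed through the Fourier transform. -/
theorem integral_gaussian_mul_eq {D : ℕ} {h : Space D → ℂ} (hh : Integrable h) (x : Space D)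
    {σ : ℝ} (hσ : 0 < σ) :
    ∫ y : Space D, Complex.exp (-(‖x - y‖ ^ 2 * σ⁻¹ : ℝ)) * h y =
      ((Real.pi * σ : ℝ) : ℂ) ^ ((D : ℂ) / 2) *
        ∫ ξ : Space D, Complex.exp (-((Real.pi ^ 2 * ‖ξ‖ ^ 2 : ℝ) * σ)) *
          ((𝐞 (inner ℝ ξ x) : ℂ) * 𝓕 h ξ) := by
  have hb : 0 < ((Real.pi ^ 2 * σ : ℝ) : ℂ).re := by
    rw [Complex.ofReal_re]; positivity
  have hπ : (Real.pi : ℂ) ≠ 0 := by exact_mod_cast Real.pi_ne_zero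
  have hσ' : (σ : ℂ) ≠ 0 := by exact_mod_cast hσ.ne'
  -- A modulated Gaussian whose Fourier transform is the Gaussian centred at `x`. Moving the
  -- transform from `φ` to `h` then needs only `φ` and `h` integrable, not `𝓕 h`.
  set φ : Space D → ℂ := fun v => Complex.exp (-((Real.pi ^ 2 * σ : ℝ) : ℂ) * ‖v‖ ^ 2 +
    2 * Real.pi * Complex.I * (inner ℝ x v : ℝ)) with hφ
  have hφi : Integrable φ := by
    have := GaussianFourier.integrable_cexp_neg_mul_sq_norm_add hb (2 * Real.pi * Complex.I) x
    simpa [hφ] using this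
  have hφF : ∀ w, 𝓕 φ w = ((Real.pi * σ : ℝ) : ℂ) ^ (-((D : ℂ) / 2)) *
      Complex.exp (-(‖x - w‖ ^ 2 * σ⁻¹ : ℝ)) := by
    intro w
    rw [hφ, fourier_gaussian_innerProductSpace' hb, finrank_euclideanSpace_fin]
    congr 1
    · rw [show (Real.pi : ℂ) / ((Real.pi ^ 2 * σ : ℝ) : ℂ) = ((Real.pi * σ : ℝ) : ℂ)⁻¹ by
        push_cast; field_simp, Complex.inv_cpow, Complex.cpow_neg]
      rw [Complex.arg_ofReal_of_nonneg (by positivity)]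
      positivity
    · congr 1
      push_cast
      field_simp
  have hpar : ∫ w, 𝓕 φ w * h w = ∫ v, φ v * 𝓕 h v := by
    simpa using! (VectorFourier.integral_fourierIntegral_smul_eq_flip (L := innerₗ (Space D))
      Real.continuous_fourierChar continuous_inner hφi hh)
  have h1 : ∀ v, φ v * 𝓕 h v = Complex.exp (-((Real.pi ^ 2 * ‖v‖ ^ 2 : ℝ) * σ)) *
      ((𝐞 (inner ℝ v x) : ℂ) * 𝓕 h v) := by
    intro v
    rw [hφ, ← mul_assoc, Real.fourierChar_apply]
    simp only
    rw [Complex.exp_add, real_inner_comm]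
    congr 3
    · push_cast; ring
    · push_cast; ring
  simp only [hφF, h1, mul_assoc] at hpar
  rw [integral_const_mul] at hpar
  rw [← hpar, ← mul_assoc, ← Complex.cpow_add _ _
    (by exact_mod_cast (mul_pos Real.pi_pos hσ).ne'), add_neg_cancel, Complex.cpow_zero, one_mul]

/-- The Fourier transform of the Riesz potential. -/
theorem riesz_potential_eq {D : ℕ} [NeZero D] {s : ℂ} (hs : s.re < 0) (hs' : -((D : ℝ) / 2) < s.re)
    {N : ℕ} (hN : D ≤ N) {C : ℝ} {h : Space D → ℂ} (hm : AEStronglyMeasurable h)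
    (hC : ∀ y, ‖h y‖ ≤ C * weight N y) (hC' : ∀ ξ, ‖𝓕 h ξ‖ ≤ C * weight N ξ) (x : Space D) :
    aCoeff D (-s) * ∫ y : Space D, ((‖x - y‖ : ℝ) : ℂ) ^ (-(2 * ((D : ℂ) / 2 + s))) * h y =
      𝓕⁻ (fun ξ : Space D => ((2 * Real.pi * ‖ξ‖ : ℝ) : ℂ) ^ (2 * s) * 𝓕 h ξ) x := by
  have hD1 : (1 : ℝ) ≤ D := by exact_mod_cast NeZero.one_le
  have hDN : (D : ℝ) ≤ N := by exact_mod_cast hN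
  have hC0 : 0 ≤ C := by
    have := (norm_nonneg _).trans (hC 0)
    exact nonneg_of_mul_nonneg_left this (weight_pos N 0)
  have hh : Integrable h :=
    ((integrable_weight hN).const_mul C).mono' hm (Eventually.of_forall hC)
  have hFm : AEStronglyMeasurable (𝓕 h) :=
    (VectorFourier.fourierIntegral_continuous Real.continuous_fourierChar
      (L := innerₗ (Space D)) continuous_inner hh).aestronglyMeasurable
  have hxy : ∀ᵐ y : Space D, 0 < ‖x - y‖ := by
    filter_upwards [Measure.ae_ne volume x] with y hy
    exact norm_pos_iff.2 (sub_ne_zero.2 hy.symm)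
  have hξ0 : ∀ᵐ ξ : Space D, 0 < ‖ξ‖ := by
    filter_upwards [Measure.ae_ne volume 0] with y hy using norm_pos_iff.2 hy
  set a : ℂ := (D : ℂ) / 2 + s with ha
  have hare : a.re = D / 2 + s.re := by
    rw [ha, Complex.add_re]; norm_num
  have ha0 : 0 < a.re := by rw [hare]; linarith
  have hs0 : 0 < (-s).re := by simpa using hs
  have hΓa := Complex.Gamma_ne_zero_of_re_pos ha0
  have hΓs := Complex.Gamma_ne_zero_of_re_pos hs0
  -- the position side
  have hpos := Gamma_mul_integral_cpow_neg (μ := volume) ha0 (r := fun y : Space D => ‖x - y‖ ^ 2)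
    (φ := h) (by fun_prop) (hxy.mono fun y hy => by positivity) hm (by
      refine Integrable.mono' ((integrable_norm_sub_rpow_mul_weight (D := D) (N := N)
        (r := 2 * (-a.re)) (by rw [hare]; linarith) (by rw [hare]; linarith) x).const_mul C)
        (AEStronglyMeasurable.mul (Measurable.aestronglyMeasurable (by fun_prop)) hm.norm)
        (Eventually.of_forall fun y => ?_)
      rw [Real.norm_of_nonneg (by positivity), Real.rpow_mul (norm_nonneg _), Real.rpow_two,
        mul_left_comm]
      gcongr
      exact hC y)
  -- the momentum side
  have hmom := Gamma_mul_integral_cpow_neg (μ := volume) hs0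
    (r := fun ξ : Space D => Real.pi ^ 2 * ‖ξ‖ ^ 2)
    (φ := fun ξ => (𝐞 (inner ℝ ξ x) : ℂ) * 𝓕 h ξ) (by fun_prop)
    (hξ0.mono fun y hy => by positivity)
    (AEStronglyMeasurable.mul (Continuous.aestronglyMeasurable (by fun_prop)) hFm) (by
      refine Integrable.mono' ((integrable_norm_rpow_mul_weight (D := D) (N := N)
        (r := 2 * s.re) (by linarith) (by linarith)).const_mul ((Real.pi ^ 2) ^ s.re * C))
        (AEStronglyMeasurable.mul (Measurable.aestronglyMeasurable (by fun_prop))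
        (AEStronglyMeasurable.mul (Continuous.aestronglyMeasurable (by fun_prop)) hFm).norm)
        (Eventually.of_forall fun y => ?_)
      rw [Real.norm_of_nonneg (by positivity), Complex.neg_re, neg_neg, norm_mul,
        Circle.norm_coe, one_mul, Real.mul_rpow (by positivity) (by positivity),
        Real.rpow_mul (norm_nonneg _), Real.rpow_two, mul_assoc, mul_assoc]
      gcongr 1
      rw [mul_left_comm C]
      gcongr
      exact hC' y)
  set G : ℝ → ℂ := fun σ => ∫ ξ : Space D, Complex.exp (-((Real.pi ^ 2 * ‖ξ‖ ^ 2 : ℝ) * σ)) *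
    ((𝐞 (inner ℝ ξ x) : ℂ) * 𝓕 h ξ) with hG
  -- With `σ = 1/τ` the Gaussian identity contributes `(π/τ)^{D/2}`, which lowers `τ^{a-1}` to
  -- `τ^{s-1}`. The inversion `τ ↦ 1/τ` then turns the Mellin transform at `s` into the one at `-s`,
  -- which is the momentum side.
  have hlink : ∫ τ in Set.Ioi (0 : ℝ), (τ : ℂ) ^ (a - 1) *
      ∫ y, Complex.exp (-(((‖x - y‖ ^ 2 : ℝ) : ℂ) * τ)) * h y =
      (Real.pi : ℂ) ^ ((D : ℂ) / 2) * mellin (fun t => G t⁻¹) s := by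
    rw [mellin, ← integral_const_mul]
    refine setIntegral_congr_fun measurableSet_Ioi fun τ hτ => ?_
    have hτ0 : 0 < τ := hτ
    have hτ' : (τ : ℂ) ≠ 0 := by exact_mod_cast hτ0.ne'
    have h1 := integral_gaussian_mul_eq hh x (inv_pos.2 hτ0)
    rw [inv_inv] at h1
    simp only [← Complex.ofReal_mul] at h1 ⊢
    simp only [hG]
    simp only [← Complex.ofReal_mul]
    rw [h1, smul_eq_mul, Complex.ofReal_mul, Complex.mul_cpow_ofReal_nonneg Real.pi_pos.le
      (inv_pos.2 hτ0).le, ha, show (D : ℂ) / 2 + s - 1 = (s - 1) + (D : ℂ) / 2 by ring,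
      Complex.cpow_add _ _ hτ', Complex.ofReal_inv, Complex.inv_cpow _ _
      (by rw [Complex.arg_ofReal_of_nonneg hτ0.le]; positivity)]
    have : (τ : ℂ) ^ ((D : ℂ) / 2) ≠ 0 := by simp [Complex.cpow_eq_zero_iff, hτ']
    field_simp
  have hmellin : mellin G (-s) = ∫ τ in Set.Ioi (0 : ℝ), (τ : ℂ) ^ (-s - 1) *
      ∫ ξ : Space D, Complex.exp (-(((Real.pi ^ 2 * ‖ξ‖ ^ 2 : ℝ) : ℂ) * τ)) *
        ((𝐞 (inner ℝ ξ x) : ℂ) * 𝓕 h ξ) := rfl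
  rw [hlink, mellin_comp_inv, hmellin, ← hmom] at hpos
  have hK : ∫ y : Space D, ((‖x - y‖ : ℝ) : ℂ) ^ (-(2 * a)) * h y =
      ∫ y : Space D, ((‖x - y‖ ^ 2 : ℝ) : ℂ) ^ (-a) * h y := by
    refine integral_congr_ae (hxy.mono fun y hy => ?_)
    simp only
    rw [sq, Complex.ofReal_mul, Complex.mul_cpow_ofReal_nonneg hy.le hy.le,
      ← Complex.cpow_add _ _ (by exact_mod_cast hy.ne')]
    ring_nf
  have hM : 𝓕⁻ (fun ξ : Space D => ((2 * Real.pi * ‖ξ‖ : ℝ) : ℂ) ^ (2 * s) * 𝓕 h ξ) x =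
      (2 : ℂ) ^ (2 * s) * ∫ ξ : Space D, ((Real.pi ^ 2 * ‖ξ‖ ^ 2 : ℝ) : ℂ) ^ (- -s) *
        ((𝐞 (inner ℝ ξ x) : ℂ) * 𝓕 h ξ) := by
    rw [Real.fourierInv_eq, ← integral_const_mul]
    refine integral_congr_ae (hξ0.mono fun y hy => ?_)
    have h2 : (0 : ℝ) ≤ Real.pi * ‖y‖ := by positivity
    have h3 : ((Real.pi * ‖y‖ : ℝ) : ℂ) ≠ 0 := by
      exact_mod_cast (mul_pos Real.pi_pos hy).ne'
    simp only
    rw [neg_neg, ← mul_pow, sq, Complex.ofReal_mul (Real.pi * ‖y‖),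
      Complex.mul_cpow_ofReal_nonneg h2 h2,
      ← Complex.cpow_add _ _ h3, mul_assoc 2 Real.pi, Complex.ofReal_mul 2,
      Complex.mul_cpow_ofReal_nonneg (by norm_num) h2, Circle.smul_def, smul_eq_mul,
      Complex.ofReal_ofNat, two_mul s]
    ring
  rw [hK, hM, aCoeff, sub_neg_eq_add, ← ha]
  have hπ : (Real.pi : ℂ) ^ ((D : ℂ) / 2) ≠ 0 := by
    simp [Complex.cpow_eq_zero_iff, Real.pi_ne_zero]
  have h2 : (2 : ℂ) ^ (2 * s) ≠ 0 := by simp [Complex.cpow_eq_zero_iff]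
  rw [mul_neg, Complex.cpow_neg]
  field_simp
  rw [hpos]
  simp only [neg_neg, mul_assoc]

/-! ### Decay of Fourier transforms by differentiation -/

lemma fourier_fderiv_apply {D : ℕ} {h : Space D → ℂ} (hs : ContDiff ℝ ∞ h)
    (hc : HasCompactSupport h) (v ξ : Space D) :
    𝓕 (fun y => fderiv ℝ h y v) ξ = 2 * Real.pi * Complex.I * (inner ℝ ξ v : ℝ) * 𝓕 h ξ := by
  have h1 : Continuous (fderiv ℝ h) := hs.continuous_fderiv (by simp)
  have hi : Integrable (fderiv ℝ h) := h1.integrable_of_hasCompactSupport (hc.fderiv ℝ)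
  have h2 := Real.fourier_fderiv (hs.continuous.integrable_of_hasCompactSupport hc)
    (hs.differentiable (by simp)) hi
  have h3 := Real.fourier_continuousLinearMap_apply (f := fderiv ℝ h) (a := v) (v := ξ) hi
  rw [← h3, h2]
  simp [VectorFourier.fourierSMulRight_apply]
  rw [innerSL_apply_apply]
  ring

/-- The operator `1 - (2π)⁻² ∑ ∂²`, the derivatives being in the directions `ι e_i`. -/
noncomputable def helmholtz {D : ℕ} {W : Type*} [NormedAddCommGroup W] [NormedSpace ℝ W]
    (ι : Space D →L[ℝ] W) (F : W → ℂ) : W → ℂ := fun z =>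
  F z - (4 * Real.pi ^ 2 : ℂ)⁻¹ * ∑ i : Fin D,
    fderiv ℝ (fun z => fderiv ℝ F z (ι (EuclideanSpace.single i 1))) z
      (ι (EuclideanSpace.single i 1))

lemma contDiff_fderiv_apply_const {W : Type*} [NormedAddCommGroup W] [NormedSpace ℝ W]
    {F : W → ℂ} (hF : ContDiff ℝ ∞ F) (v : W) : ContDiff ℝ ∞ (fun z => fderiv ℝ F z v) :=
  (hF.fderiv_right (by simp)).clm_apply contDiff_const

lemma contDiff_helmholtz {D : ℕ} {W : Type*} [NormedAddCommGroup W] [NormedSpace ℝ W]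
    (ι : Space D →L[ℝ] W) {F : W → ℂ} (hF : ContDiff ℝ ∞ F) : ContDiff ℝ ∞ (helmholtz ι F) :=
  hF.sub (contDiff_const.mul (ContDiff.sum fun _ _ =>
    contDiff_fderiv_apply_const (contDiff_fderiv_apply_const hF _) _))

lemma fderiv_comp_const_add {D : ℕ} {W : Type*} [NormedAddCommGroup W] [NormedSpace ℝ W]
    (ι : Space D →L[ℝ] W) {F : W → ℂ} (hF : ContDiff ℝ ∞ F) (z₀ : W) (y v : Space D) :
    fderiv ℝ (fun y => F (z₀ + ι y)) y v = fderiv ℝ F (z₀ + ι y) (ι v) := by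
  have h1 : HasFDerivAt (fun y => z₀ + ι y) ι y := ι.hasFDerivAt.const_add z₀
  have h2 : HasFDerivAt F (fderiv ℝ F (z₀ + ι y)) (z₀ + ι y) :=
    (hF.differentiable (by simp) _).hasFDerivAt
  have h3 : HasFDerivAt (fun y => F (z₀ + ι y)) ((fderiv ℝ F (z₀ + ι y)).comp ι) y := h2.comp y h1
  rw [h3.fderiv]
  rfl

/-- Each derivative contributes `2πi⟨ξ, v⟩`, so the factor `(4π²)⁻¹` makes the symbol exactly `1 +
‖ξ‖²`, the reciprocal of `weight 1`. Working along `ι` on `W` keeps the result a function of both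
variables and of the parameter, so the operator can be iterated in either variable. -/
lemma fourier_helmholtz {D : ℕ} {W : Type*} [NormedAddCommGroup W] [NormedSpace ℝ W]
    (ι : Space D →L[ℝ] W) {F : W → ℂ} (hF : ContDiff ℝ ∞ F) (z₀ : W)
    (hc : HasCompactSupport fun y => F (z₀ + ι y)) (ξ : Space D) :
    𝓕 (fun y => helmholtz ι F (z₀ + ι y)) ξ =
      ((1 + ‖ξ‖ ^ 2 : ℝ) : ℂ) * 𝓕 (fun y => F (z₀ + ι y)) ξ := by
  set h : Space D → ℂ := fun y => F (z₀ + ι y) with hh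
  have hs : ContDiff ℝ ∞ h := hF.comp (contDiff_const.add ι.contDiff)
  have hd : ∀ v : Space D, HasCompactSupport fun y => fderiv ℝ h y v := fun v =>
    (hc.fderiv ℝ).comp_left (g := fun L : Space D →L[ℝ] ℂ => L v) rfl
  have e1 : ∀ v y, fderiv ℝ (fun z => fderiv ℝ F z (ι v)) (z₀ + ι y) (ι v) =
      fderiv ℝ (fun y => fderiv ℝ h y v) y v := by
    intro v y
    rw [← fderiv_comp_const_add ι (contDiff_fderiv_apply_const hF (ι v))]
    congr 2
    ext y
    rw [hh, fderiv_comp_const_add ι hF]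
  have hint : ∀ v, Integrable fun y => fderiv ℝ (fun y => fderiv ℝ h y v) y v := by
    intro v
    have := contDiff_fderiv_apply_const (contDiff_fderiv_apply_const hs v) v
    refine this.continuous.integrable_of_hasCompactSupport ?_
    exact ((hd v).fderiv ℝ).comp_left (g := fun L : Space D →L[ℝ] ℂ => L v) rfl
  have hhint : Integrable h := hs.continuous.integrable_of_hasCompactSupport hc
  have key : ∀ v : Space D, 𝓕 (fun y => fderiv ℝ (fun y => fderiv ℝ h y v) y v) ξ =
      -(4 * Real.pi ^ 2) * ((inner ℝ ξ v : ℝ) : ℂ) ^ 2 * 𝓕 h ξ := by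
    intro v
    rw [fourier_fderiv_apply (contDiff_fderiv_apply_const hs v) (hd v),
      fourier_fderiv_apply hs hc]
    linear_combination (4 * Real.pi ^ 2 * ((inner ℝ ξ v : ℝ) : ℂ) ^ 2 * 𝓕 h ξ) * Complex.I_sq
  have hnorm : ((‖ξ‖ ^ 2 : ℝ) : ℂ) =
      ∑ i : Fin D, ((inner ℝ ξ (EuclideanSpace.single i (1 : ℝ)) : ℝ) : ℂ) ^ 2 := by
    rw [EuclideanSpace.norm_sq_eq]
    push_cast
    refine Finset.sum_congr rfl fun i _ => ?_
    rw [EuclideanSpace.inner_single_right]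
    simp [← Complex.ofReal_pow]
  have hπ : (4 * Real.pi ^ 2 : ℂ) ≠ 0 := by simp
  have hchar : ∀ {f : Space D → ℂ}, Integrable f → Integrable fun y => 𝐞 (-inner ℝ y ξ) • f y :=
    fun hf => (Real.fourierIntegral_convergent_iff ξ).2 hf
  have e2 : ∀ y, helmholtz ι F (z₀ + ι y) = h y - (4 * Real.pi ^ 2 : ℂ)⁻¹ * ∑ i : Fin D,
      fderiv ℝ (fun y => fderiv ℝ h y (EuclideanSpace.single i 1)) y
        (EuclideanSpace.single i 1) := by
    intro y
    simp only [helmholtz, e1]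
    rfl
  simp only [e2]
  rw [Real.fourier_eq]
  simp only [smul_sub, Finset.mul_sum, Finset.smul_sum]
  rw [integral_sub (hchar hhint) (integrable_finsetSum _ fun i _ => hchar ((hint _).const_mul _)),
    integral_finsetSum _ fun i _ => hchar ((hint _).const_mul _)]
  simp only [← mul_smul_comm, integral_const_mul, ← Real.fourier_eq, key]
  rw [Complex.ofReal_add, hnorm, add_mul, Finset.sum_mul, Complex.ofReal_one, one_mul, sub_eq_add_neg,
    ← Finset.sum_neg_distrib]
  congr 1
  refine Finset.sum_congr rfl fun i _ => ?_
  field_simp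

/-! ### Smooth compactly supported families and their partial Fourier transforms -/

/-- Smooth families, parametrized by `u ∈ ℂ`, of functions on `ℝ^D × ℝ^D` vanishing outside `K`. -/
structure IsSmoothFamily {D : ℕ} (K : Set (Space D × Space D)) (F : ℂ × Space D × Space D → ℂ) :
    Prop where
  contDiff : ContDiff ℝ ∞ F
  eq_zero : ∀ z, z.2 ∉ K → F z = 0

namespace IsSmoothFamily

variable {D : ℕ} {K : Set (Space D × Space D)} {F : ℂ × Space D × Space D → ℂ}

lemma fderiv_apply (hF : IsSmoothFamily K F) (hK : IsCompact K) (v : ℂ × Space D × Space D) :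
    IsSmoothFamily K (fun z => fderiv ℝ F z v) where
  contDiff := contDiff_fderiv_apply_const hF.contDiff v
  eq_zero z hz := by
    have : F =ᶠ[𝓝 z] fun _ => 0 := by
      filter_upwards [(hK.isClosed.isOpen_compl.preimage continuous_snd).mem_nhds hz] with w hw
      exact hF.eq_zero w hw
    rw [this.fderiv_eq]
    simp

lemma helmholtz (hF : IsSmoothFamily K F) (hK : IsCompact K)
    (ι : Space D →L[ℝ] ℂ × Space D × Space D) : IsSmoothFamily K (helmholtz ι F) where
  contDiff := contDiff_helmholtz ι hF.contDiff
  eq_zero z hz := by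
    simp only [ConformalR.helmholtz]
    rw [hF.eq_zero z hz, Finset.sum_eq_zero fun i _ =>
      ((hF.fderiv_apply hK _).fderiv_apply hK _).eq_zero z hz]
    simp

lemma helmholtz_iterate (hF : IsSmoothFamily K F) (hK : IsCompact K)
    (ι : Space D →L[ℝ] ℂ × Space D × Space D) (n : ℕ) :
    IsSmoothFamily K ((ConformalR.helmholtz ι)^[n] F) := by
  induction n with
  | zero => exact hF
  | succ n ih =>
    rw [Function.iterate_succ_apply']
    exact ih.helmholtz hK ι

/-- Continuity on the compact set `closedBall 0 R ×ˢ K`. Uniformity in `u` is what dominated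
convergence in the parameter uses later. -/
lemma exists_norm_le (hF : IsSmoothFamily K F) (hK : IsCompact K) (N : ℕ) (R : ℝ) :
    ∃ C, 0 ≤ C ∧ ∀ u : ℂ, ‖u‖ ≤ R → ∀ y₁ y₂, ‖F (u, y₁, y₂)‖ ≤ C * weight N y₁ * weight N y₂ := by
  have hcpt : IsCompact (Metric.closedBall (0 : ℂ) R ×ˢ K) :=
    (isCompact_closedBall 0 R).prod hK
  have hcont : Continuous fun z : ℂ × Space D × Space D =>
      (weight N z.2.1 * weight N z.2.2)⁻¹ * ‖F z‖ := by
    refine Continuous.mul (Continuous.inv₀ (by fun_prop) fun z => ?_) hF.contDiff.continuous.norm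
    exact (mul_pos (weight_pos _ _) (weight_pos _ _)).ne'
  obtain ⟨C, hC⟩ := hcpt.exists_bound_of_continuousOn hcont.continuousOn
  refine ⟨|C|, abs_nonneg C, fun u hu y₁ y₂ => ?_⟩
  have hw := mul_pos (weight_pos N y₁) (weight_pos N y₂)
  by_cases hy : (y₁, y₂) ∈ K
  · have := hC (u, y₁, y₂) ⟨by simpa using hu, hy⟩
    rw [Real.norm_of_nonneg (by positivity), inv_mul_le_iff₀ hw] at this
    rw [mul_assoc, mul_comm]
    exact this.trans (by gcongr; exact le_abs_self C)
  · rw [hF.eq_zero _ hy, norm_zero]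
    rw [mul_assoc]
    positivity

lemma hasCompactSupport_left (hF : IsSmoothFamily K F) (hK : IsCompact K) (u : ℂ) (y₂ : Space D) :
    HasCompactSupport fun y₁ => F (u, y₁, y₂) :=
  HasCompactSupport.intro (hK.image continuous_fst) fun _ hy => hF.eq_zero _ fun h =>
    hy ⟨_, h, rfl⟩

lemma hasCompactSupport_right (hF : IsSmoothFamily K F) (hK : IsCompact K) (u : ℂ) (y₁ : Space D) :
    HasCompactSupport fun y₂ => F (u, y₁, y₂) :=
  HasCompactSupport.intro (hK.image continuous_snd) fun _ hy => hF.eq_zero _ fun h =>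
    hy ⟨_, h, rfl⟩

/-- Bounding the transform of the `n`-th iterate uniformly in `ξ` therefore yields decay like
`weight n` for the transform of `F` itself. -/
lemma fourier_left (hF : IsSmoothFamily K F) (hK : IsCompact K) (n : ℕ) (u : ℂ) (y₂ ξ : Space D) :
    𝓕 (fun y₁ => (ConformalR.helmholtz ((ContinuousLinearMap.inr ℝ ℂ (Space D × Space D)).comp
      (ContinuousLinearMap.inl ℝ (Space D) (Space D))))^[n] F (u, y₁, y₂)) ξ =
      (weight n ξ : ℂ)⁻¹ * 𝓕 (fun y₁ => F (u, y₁, y₂)) ξ := by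
  induction n with
  | zero => simp [weight]
  | succ n ih =>
    have hFn := hF.helmholtz_iterate hK ((ContinuousLinearMap.inr ℝ ℂ (Space D × Space D)).comp
      (ContinuousLinearMap.inl ℝ (Space D) (Space D))) n
    rw [Function.iterate_succ']
    have h := fourier_helmholtz ((ContinuousLinearMap.inr ℝ ℂ (Space D × Space D)).comp
      (ContinuousLinearMap.inl ℝ (Space D) (Space D))) hFn.contDiff (u, 0, y₂)
      (by simpa using! hFn.hasCompactSupport_left hK u y₂) ξ
    simp only [ContinuousLinearMap.comp_apply, ContinuousLinearMap.inl_apply,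
      ContinuousLinearMap.inr_apply, Prod.mk_add_mk, add_zero, zero_add] at h
    simp only [Function.comp_apply]
    rw [h, ih]
    simp only [weight, pow_succ]
    push_cast
    simp only [inv_inv]
    ring

lemma fourier_right (hF : IsSmoothFamily K F) (hK : IsCompact K) (n : ℕ) (u : ℂ) (y₁ ξ : Space D) :
    𝓕 (fun y₂ => (ConformalR.helmholtz ((ContinuousLinearMap.inr ℝ ℂ (Space D × Space D)).comp
      (ContinuousLinearMap.inr ℝ (Space D) (Space D))))^[n] F (u, y₁, y₂)) ξ =
      (weight n ξ : ℂ)⁻¹ * 𝓕 (fun y₂ => F (u, y₁, y₂)) ξ := by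
  induction n with
  | zero => simp [weight]
  | succ n ih =>
    have hFn := hF.helmholtz_iterate hK ((ContinuousLinearMap.inr ℝ ℂ (Space D × Space D)).comp
      (ContinuousLinearMap.inr ℝ (Space D) (Space D))) n
    rw [Function.iterate_succ']
    have h := fourier_helmholtz ((ContinuousLinearMap.inr ℝ ℂ (Space D × Space D)).comp
      (ContinuousLinearMap.inr ℝ (Space D) (Space D))) hFn.contDiff (u, y₁, 0)
      (by simpa using! hFn.hasCompactSupport_right hK u y₁) ξ
    simp only [ContinuousLinearMap.comp_apply,
      ContinuousLinearMap.inr_apply, Prod.mk_add_mk, add_zero, zero_add] at h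
    simp only [Function.comp_apply]
    rw [h, ih]
    simp only [weight, pow_succ]
    push_cast
    simp only [inv_inv]
    ring

end IsSmoothFamily

/-- The Fourier transform if `b` is true, the identity otherwise. -/
noncomputable def transf {D : ℕ} (b : Bool) (h : Space D → ℂ) : Space D → ℂ := bif b then 𝓕 h else h

/-- `transf b₁` in the first variable, followed by `transf b₂` in the second one. -/
noncomputable def transf₂ {D : ℕ} (b₁ b₂ : Bool) (G : Space D → Space D → ℂ) (y₁ y₂ : Space D) : ℂ :=
  transf b₂ (fun z₂ => transf b₁ (fun z₁ => G z₁ z₂) y₁) y₂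

lemma transf_const_mul {D : ℕ} (b : Bool) (c : ℂ) (h : Space D → ℂ) (y : Space D) :
    transf b (fun z => c * h z) y = c * transf b h y := by
  cases b
  · rfl
  · simp only [transf, cond_true, Real.fourier_eq, ← mul_smul_comm, integral_const_mul]

lemma stronglyMeasurable_transf_left {D : ℕ} {α : Type*} [MeasurableSpace α] (b : Bool)
    {G : Space D → α → ℂ}
    (hG : StronglyMeasurable (Function.uncurry G)) :
    StronglyMeasurable (fun p : Space D × α => transf b (fun z => G z p.2) p.1) := by
  cases b
  · exact hG
  · simp only [transf, cond_true, Real.fourier_eq]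
    refine StronglyMeasurable.integral_prod_right
      (f := fun (p : Space D × α) (v : Space D) => 𝐞 (-inner ℝ v p.1) • G v p.2) ?_
    have h1 : Continuous fun q : (Space D × Space D) => (𝐞 (-inner ℝ q.1 q.2) : ℂ) := by fun_prop
    exact (h1.stronglyMeasurable.comp_measurable
      (g := fun q : (Space D × α) × Space D => (q.2, q.1.1)) (by fun_prop)).mul
      (hG.comp_measurable (g := fun q : (Space D × α) × Space D => (q.2, q.1.2)) (by fun_prop))

lemma stronglyMeasurable_transf₂ {D : ℕ} (b₁ b₂ : Bool) {G : Space D → Space D → ℂ}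
    (hG : StronglyMeasurable (Function.uncurry G)) :
    StronglyMeasurable (Function.uncurry (transf₂ b₁ b₂ G)) := by
  have h1 := stronglyMeasurable_transf_left b₁ hG
  have h2 := stronglyMeasurable_transf_left b₂
    (G := fun z₂ y₁ => transf b₁ (fun z₁ => G z₁ z₂) y₁)
    (h1.comp_measurable measurable_swap)
  exact h2.comp_measurable measurable_swap

lemma norm_fourier_le_integral_norm {D : ℕ} {h : Space D → ℂ} (y : Space D) :
    ‖𝓕 h y‖ ≤ ∫ z, ‖h z‖ := by
  rw [Real.fourier_eq]
  refine (norm_integral_le_integral_norm _).trans_eq ?_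
  simp [Circle.smul_def, Circle.norm_coe]

lemma norm_fourier_le_of_le {D : ℕ} [NeZero D] {N : ℕ} (hN : D ≤ N) {h : Space D → ℂ} {C : ℝ}
    (hC : ∀ y, ‖h y‖ ≤ C * weight N y) (y : Space D) :
    ‖𝓕 h y‖ ≤ C * ∫ z : Space D, weight N z := by
  refine (norm_fourier_le_integral_norm y).trans ?_
  rw [← integral_const_mul]
  exact integral_mono_of_nonneg (Eventually.of_forall fun _ => norm_nonneg _)
    ((integrable_weight hN).const_mul C) (Eventually.of_forall hC)

/-- Partial Fourier transforms commute. -/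
lemma fourier_fourier_comm {D : ℕ} {G : Space D → Space D → ℂ}
    (hG : Integrable (Function.uncurry G)) (y₁ y₂ : Space D) :
    𝓕 (fun z₂ => 𝓕 (fun z₁ => G z₁ z₂) y₁) y₂ = 𝓕 (fun z₁ => 𝓕 (fun z₂ => G z₁ z₂) y₂) y₁ := by
  simp only [Real.fourier_eq, Circle.smul_def, smul_eq_mul, ← integral_const_mul]
  rw [integral_integral_swap]
  · simp only [mul_left_comm]
  · have h1 : Continuous fun p : Space D × Space D =>
        ((𝐞 (-inner ℝ p.1 y₂) : ℂ) * (𝐞 (-inner ℝ p.2 y₁) : ℂ)) := by fun_prop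
    refine (hG.swap.norm).mono' ?_ (Eventually.of_forall fun p => ?_)
    · refine (h1.aestronglyMeasurable.mul hG.swap.aestronglyMeasurable).congr
        (Eventually.of_forall fun p => ?_)
      simp [Function.uncurry, mul_assoc]
    · simp [Function.uncurry, Circle.norm_coe]

namespace IsSmoothFamily

variable {D : ℕ} {K : Set (Space D × Space D)} {F : ℂ × Space D × Space D → ℂ}

lemma stronglyMeasurable (hF : IsSmoothFamily K F) (u : ℂ) :
    StronglyMeasurable (Function.uncurry fun y₁ y₂ => F (u, y₁, y₂)) := by
  have := hF.contDiff.continuous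
  exact Continuous.stronglyMeasurable (by fun_prop)

lemma integrable [NeZero D] (hF : IsSmoothFamily K F) (hK : IsCompact K) (u : ℂ) :
    Integrable (Function.uncurry fun y₁ y₂ => F (u, y₁, y₂)) := by
  obtain ⟨C, -, hC⟩ := hF.exists_norm_le hK D ‖u‖
  refine Integrable.mono' (((integrable_weight le_rfl).mul_prod (integrable_weight le_rfl)).const_mul C)
    (hF.stronglyMeasurable u).aestronglyMeasurable (Eventually.of_forall fun p => ?_)
  rw [← mul_assoc]
  exact hC u le_rfl p.1 p.2

/-- All partial Fourier transforms of a smooth family decay rapidly. -/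
lemma exists_norm_transf₂_le [NeZero D] (hF : IsSmoothFamily K F) (hK : IsCompact K) (b₁ b₂ : Bool)
    {N : ℕ} (hN : D ≤ N) (R : ℝ) :
    ∃ C, 0 ≤ C ∧ ∀ u : ℂ, ‖u‖ ≤ R → ∀ y₁ y₂,
      ‖transf₂ b₁ b₂ (fun y₁ y₂ => F (u, y₁, y₂)) y₁ y₂‖ ≤ C * weight N y₁ * weight N y₂ := by
  have hI : 0 ≤ ∫ z : Space D, weight N z := integral_nonneg fun z => (weight_pos N z).le
  have hnorm : ∀ (y : Space D) (z : ℂ), ‖z‖ = weight N y * ‖(weight N y : ℂ)⁻¹ * z‖ := by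
    intro y z
    have := weight_pos N y
    rw [norm_mul, norm_inv, Complex.norm_real, Real.norm_of_nonneg this.le]
    field_simp
  cases b₁ <;> cases b₂
  · exact hF.exists_norm_le hK N R
  · obtain ⟨C, hC0, hC⟩ := (hF.helmholtz_iterate hK ((ContinuousLinearMap.inr ℝ ℂ
      (Space D × Space D)).comp (ContinuousLinearMap.inr ℝ (Space D) (Space D))) N).exists_norm_le
      hK N R
    refine ⟨C * ∫ z : Space D, weight N z, by positivity, fun u hu y₁ y₂ => ?_⟩
    simp only [transf₂, transf, cond_true, cond_false]
    rw [hnorm y₂, ← hF.fourier_right hK, mul_comm (weight N y₂)]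
    gcongr
    · exact (weight_pos N y₂).le
    · refine (norm_fourier_le_of_le hN (hC u hu y₁) y₂).trans_eq ?_
      ring
  · obtain ⟨C, hC0, hC⟩ := (hF.helmholtz_iterate hK ((ContinuousLinearMap.inr ℝ ℂ
      (Space D × Space D)).comp (ContinuousLinearMap.inl ℝ (Space D) (Space D))) N).exists_norm_le
      hK N R
    refine ⟨C * ∫ z : Space D, weight N z, by positivity, fun u hu y₁ y₂ => ?_⟩
    simp only [transf₂, transf, cond_true, cond_false]
    rw [hnorm y₁, ← hF.fourier_left hK, mul_right_comm, mul_comm _ (weight N y₁)]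
    gcongr
    · exact (weight_pos N y₁).le
    · refine (norm_fourier_le_of_le hN (C := C * weight N y₂) (fun y => ?_) y₁).trans_eq ?_
      · refine (hC u hu y y₂).trans_eq ?_
        ring
      · ring
  · have hF₂ := hF.helmholtz_iterate hK ((ContinuousLinearMap.inr ℝ ℂ
      (Space D × Space D)).comp (ContinuousLinearMap.inr ℝ (Space D) (Space D))) N
    obtain ⟨C, hC0, hC⟩ := (hF₂.helmholtz_iterate hK ((ContinuousLinearMap.inr ℝ ℂ
      (Space D × Space D)).comp (ContinuousLinearMap.inl ℝ (Space D) (Space D))) N).exists_norm_le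
      hK N R
    refine ⟨C * (∫ z : Space D, weight N z) * ∫ z : Space D, weight N z, by positivity,
      fun u hu y₁ y₂ => ?_⟩
    simp only [transf₂, transf, cond_true]
    -- The transform in the second variable is the outer one, while `fourier_right` treats an inner
    -- one: the order is exchanged, the weight extracted, and the order restored.
    have e1 : (weight N y₂ : ℂ)⁻¹ * 𝓕 (fun z₂ => 𝓕 (fun z₁ => F (u, z₁, z₂)) y₁) y₂ =
        𝓕 (fun z₂ => 𝓕 (fun z₁ => (ConformalR.helmholtz ((ContinuousLinearMap.inr ℝ ℂ
          (Space D × Space D)).comp (ContinuousLinearMap.inr ℝ (Space D) (Space D))))^[N] F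
          (u, z₁, z₂)) y₁) y₂ := by
      rw [fourier_fourier_comm (hF.integrable hK u), fourier_fourier_comm (hF₂.integrable hK u)]
      simp only [hF.fourier_right hK]
      exact (transf_const_mul true _ _ _).symm
    have e2 : (weight N y₁ : ℂ)⁻¹ * 𝓕 (fun z₂ => 𝓕 (fun z₁ => (ConformalR.helmholtz
          ((ContinuousLinearMap.inr ℝ ℂ (Space D × Space D)).comp
          (ContinuousLinearMap.inr ℝ (Space D) (Space D))))^[N] F (u, z₁, z₂)) y₁) y₂ =
        𝓕 (fun z₂ => 𝓕 (fun z₁ => (ConformalR.helmholtz ((ContinuousLinearMap.inr ℝ ℂ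
          (Space D × Space D)).comp (ContinuousLinearMap.inl ℝ (Space D) (Space D))))^[N]
          ((ConformalR.helmholtz ((ContinuousLinearMap.inr ℝ ℂ
          (Space D × Space D)).comp (ContinuousLinearMap.inr ℝ (Space D) (Space D))))^[N] F)
          (u, z₁, z₂)) y₁) y₂ := by
      simp only [hF₂.fourier_left hK]
      exact (transf_const_mul true _ _ _).symm
    rw [hnorm y₂, e1, hnorm y₁, e2, ← mul_assoc, mul_comm (weight N y₂ * _), mul_assoc _ (weight N y₁),
      mul_comm (weight N y₁)]
    gcongr
    · exact (mul_pos (weight_pos _ _) (weight_pos _ _)).le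
    · refine norm_fourier_le_of_le hN (fun z₂ => ?_) y₂
      refine (norm_fourier_le_of_le hN (C := C * weight N z₂) (fun y => ?_) y₁).trans_eq ?_
      · refine (hC u hu y z₂).trans_eq ?_
        ring
      · ring

/-- Partial Fourier transforms of a holomorphic smooth family are holomorphic. -/
lemma differentiable_transf₂ [NeZero D] (hF : IsSmoothFamily K F) (hK : IsCompact K)
    (hd : ∀ y, Differentiable ℂ fun u => F (u, y)) (b₁ b₂ : Bool) (y₁ y₂ : Space D) :
    Differentiable ℂ fun u => transf₂ b₁ b₂ (fun y₁ y₂ => F (u, y₁, y₂)) y₁ y₂ := by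
  -- Holomorphy under one transform, for families dominated by a weight locally uniformly in `u`. It
  -- is used once per variable; in the second use the domination is the decay of the first
  -- transform.
  have step : ∀ (b : Bool) (H : ℂ → Space D → ℂ) (y : Space D), (∀ u, StronglyMeasurable (H u)) →
      (∀ z, Differentiable ℂ fun u => H u z) →
      (∀ R : ℝ, ∃ C, ∀ u : ℂ, ‖u‖ ≤ R → ∀ z, ‖H u z‖ ≤ C * weight D z) →
      Differentiable ℂ fun u => transf b (H u) y := by
    intro b H y hm hdiff hb
    cases b
    · exact hdiff y
    · intro u₀
      obtain ⟨C, hC⟩ := hb (‖u₀‖ + 1)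
      simp only [transf, cond_true, Real.fourier_eq, Circle.smul_def, smul_eq_mul]
      refine (differentiableOn_integral_of_dominated (U := Metric.ball 0 (‖u₀‖ + 1))
        (bound := fun z => C * weight D z) Metric.isOpen_ball (fun u _ => ?_)
        ((integrable_weight le_rfl).const_mul C) (Eventually.of_forall fun z u hu => ?_)
        (Eventually.of_forall fun z => ?_)).differentiableAt
        (Metric.isOpen_ball.mem_nhds (by simp))
      · exact (Continuous.aestronglyMeasurable (by fun_prop)).mul (hm u).aestronglyMeasurable
      · rw [norm_mul, Circle.norm_coe, one_mul]
        exact hC u (by simpa using (Metric.mem_ball.1 hu).le) z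
      · exact ((hdiff z).const_mul _).differentiableOn
  refine step b₂ (fun u z₂ => transf b₁ (fun z₁ => F (u, z₁, z₂)) y₁) y₂ (fun u => ?_)
    (fun z₂ => ?_) fun R => ?_
  · exact (stronglyMeasurable_transf_left b₁ (hF.stronglyMeasurable u)).comp_measurable
      (g := fun z₂ => (y₁, z₂)) (by fun_prop)
  · refine step b₁ (fun u z₁ => F (u, z₁, z₂)) y₁ (fun u => ?_) (fun z₁ => hd (z₁, z₂)) fun R => ?_
    · exact (hF.stronglyMeasurable u).comp_measurable (g := fun z₁ => (z₁, z₂)) (by fun_prop)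
    · obtain ⟨C, -, hC⟩ := hF.exists_norm_le hK D R
      refine ⟨C * weight D z₂, fun u hu z₁ => (hC u hu z₁ z₂).trans_eq ?_⟩
      ring
  · obtain ⟨C, -, hC⟩ := hF.exists_norm_transf₂_le hK b₁ false le_rfl R
    exact ⟨C * weight D y₁, fun u hu z₂ => hC u hu y₁ z₂⟩

end IsSmoothFamily

/-! ### Integral kernels and holomorphy in the spectral parameter -/

/-- The kernel of `p^{2s}`, acting on `h` (`b = false`) or on the Fourier transform of `h`
(`b = true`). -/
noncomputable def kern {D : ℕ} (b : Bool) (s : ℂ) (x y : Space D) : ℂ :=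
  bif b then (𝐞 (inner ℝ y x) : ℂ) * ((2 * Real.pi * ‖y‖ : ℝ) : ℂ) ^ (2 * s)
  else ((‖x - y‖ : ℝ) : ℂ) ^ (-(2 * ((D : ℂ) / 2 + s)))

/-- The normalization that goes with `kern`. -/
noncomputable def kernCoeff (D : ℕ) (b : Bool) (s : ℂ) : ℂ := bif b then 1 else aCoeff D (-s)

/-- The half-plane in which `kern b s` is locally integrable. -/
def kernDomain (D : ℕ) (b : Bool) : Set ℂ :=
  bif b then {s | -((D : ℝ) / 2) < s.re} else {s | s.re < 0}

/-- Either representation may be used throughout its own half-plane: where `pPow` is defined by the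
other formula, `riesz_potential_eq` bridges the two. This is why decay of both `h` and `𝓕 h` is
assumed. -/
lemma pPow_eq_integral_kern {D : ℕ} [NeZero D] (b : Bool) {s : ℂ} (hs : s ∈ kernDomain D b)
    {N : ℕ} (hN : D ≤ N) {C : ℝ} {h : Space D → ℂ} (hm : AEStronglyMeasurable h)
    (hC : ∀ b y, ‖transf b h y‖ ≤ C * weight N y) (x : Space D) :
    pPow s h x = kernCoeff D b s * ∫ y, kern b s x y * transf b h y := by
  have hF : 𝓕⁻ (fun ξ : Space D => ((2 * Real.pi * ‖ξ‖ : ℝ) : ℂ) ^ (2 * s) * 𝓕 h ξ) x =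
      ∫ y, kern true s x y * 𝓕 h y := by
    simp only [Real.fourierInv_eq, kern, cond_true, Circle.smul_def, smul_eq_mul, mul_assoc]
  cases b
  · simp only [kernDomain, cond_false, Set.mem_ofPred_eq] at hs
    simp only [pPow, if_pos hs, kernCoeff, kern, transf, cond_false]
  · simp only [kernDomain, cond_true, Set.mem_ofPred_eq] at hs
    simp only [kernCoeff, transf, cond_true, one_mul]
    rw [← hF, pPow]
    split_ifs with h0
    · exact riesz_potential_eq h0 hs hN hm (hC false) (hC true) x
    · rfl

@[fun_prop]
lemma measurable_kern {D : ℕ} (b : Bool) (s : ℂ) (x : Space D) : Measurable (kern b s x) := by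
  cases b
  · change Measurable fun y => ((‖x - y‖ : ℝ) : ℂ) ^ (-(2 * ((D : ℂ) / 2 + s)))
    fun_prop
  · change Measurable fun y : Space D =>
      (𝐞 (inner ℝ y x) : ℂ) * ((2 * Real.pi * ‖y‖ : ℝ) : ℂ) ^ (2 * s)
    refine Measurable.mul (Continuous.measurable (by fun_prop)) (by fun_prop)

lemma ae_differentiable_kern {D : ℕ} [NeZero D] (b : Bool) (x : Space D) :
    ∀ᵐ y, Differentiable ℂ fun s => kern b s x y := by
  cases b
  · filter_upwards [Measure.ae_ne volume x] with y hy
    have : ((‖x - y‖ : ℝ) : ℂ) ≠ 0 := by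
      simpa using sub_ne_zero.2 hy.symm
    simp only [kern, cond_false]
    intro s
    exact DifferentiableAt.const_cpow (by fun_prop) (Or.inl this)
  · filter_upwards [Measure.ae_ne volume 0] with y hy
    have : ((2 * Real.pi * ‖y‖ : ℝ) : ℂ) ≠ 0 := by
      simpa [Real.pi_ne_zero] using hy
    simp only [kern, cond_true]
    intro s
    exact (DifferentiableAt.const_cpow (by fun_prop) (Or.inl this)).const_mul _

/-- One majorant for all exponents in an interval: the lower endpoint dominates for `a ≤ 1`, the
upper one for `a ≥ 1`. -/
lemma rpow_le_add_rpow {a p q r : ℝ} (ha : 0 < a) (hpq : p ≤ q) (hqr : q ≤ r) :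
    a ^ q ≤ a ^ p + a ^ r := by
  have h1 : 0 < a ^ p := by positivity
  have h2 : 0 < a ^ r := by positivity
  rcases le_total a 1 with h | h
  · linarith [Real.rpow_le_rpow_of_exponent_ge ha h hpq]
  · linarith [Real.rpow_le_rpow_of_exponent_le h hqr]

/-- The majorant is the sum of the powers with the two extreme exponents over the ball. Its
singularity is integrable because the ball stays inside the half-plane, and `N₀` is large enough for
the weight to absorb its growth. -/
lemma exists_kern_bound {D : ℕ} [NeZero D] (b : Bool) {s₀ : ℂ} (hs₀ : s₀ ∈ kernDomain D b)
    (x : Space D) : ∃ ε > 0, ∃ N₀ : ℕ, ∃ β : Space D → ℝ, (∀ y, 0 ≤ β y) ∧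
      (∀ N, N₀ ≤ N → Integrable fun y => β y * weight N y) ∧
      (∀ s ∈ Metric.ball s₀ ε, s ∈ kernDomain D b) ∧
      ∀ᵐ y, ∀ s ∈ Metric.ball s₀ ε, ‖kern b s x y‖ ≤ β y := by
  have hre : ∀ {ε : ℝ} {s : ℂ}, s ∈ Metric.ball s₀ ε → |s.re - s₀.re| < ε := by
    intro ε s hs
    rw [← Complex.sub_re]
    exact (Complex.abs_re_le_norm _).trans_lt (by rwa [← dist_eq_norm])
  cases b
  · simp only [kernDomain, cond_false, Set.mem_ofPred_eq] at hs₀ ⊢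
    -- Half the distance from `s₀` to the boundary of the half-plane.
    set ε := -s₀.re / 2 with hε
    have hε0 : 0 < ε := by linarith
    obtain ⟨N₀, hN₀⟩ := exists_nat_gt (|-(2 * (s₀.re + ε))| + |-(2 * (s₀.re - ε))|)
    have a1 := le_abs_self (-(2 * (s₀.re + ε)))
    have a2 := le_abs_self (-(2 * (s₀.re - ε)))
    have a3 := abs_nonneg (-(2 * (s₀.re + ε)))
    have a4 := abs_nonneg (-(2 * (s₀.re - ε)))
    refine ⟨ε, hε0, N₀, fun y => ‖x - y‖ ^ (-D - 2 * (s₀.re + ε)) + ‖x - y‖ ^ (-D - 2 * (s₀.re - ε)),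
      fun y => by positivity, fun N hN => ?_, fun s hs => ?_, ?_⟩
    · have hN' : (N₀ : ℝ) ≤ N := by exact_mod_cast hN
      simp only [add_mul]
      exact (integrable_norm_sub_rpow_mul_weight (by linarith) (by linarith) x).add
        (integrable_norm_sub_rpow_mul_weight (by linarith) (by linarith) x)
    · linarith [(abs_lt.1 (hre hs)).2]
    · filter_upwards [Measure.ae_ne volume x] with y hy s hs
      have h0 : 0 < ‖x - y‖ := norm_pos_iff.2 (sub_ne_zero.2 hy.symm)
      have h1 := abs_lt.1 (hre hs)
      simp only [kern, cond_false]
      rw [Complex.norm_cpow_eq_rpow_re_of_pos h0]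
      have : (-(2 * ((D : ℂ) / 2 + s))).re = -D - 2 * s.re := by
        rw [mul_add, mul_div_cancel₀ _ two_ne_zero]
        simp
        ring
      rw [this]
      exact rpow_le_add_rpow h0 (by linarith) (by linarith)
  · simp only [kernDomain, cond_true, Set.mem_ofPred_eq] at hs₀ ⊢
    -- Again half the distance to the boundary, now the line `Re s = -D/2`.
    set ε := (s₀.re + D / 2) / 2 with hε
    have hε0 : 0 < ε := by linarith
    obtain ⟨N₀, hN₀⟩ := exists_nat_gt (D + |2 * (s₀.re + ε)| + |2 * (s₀.re - ε)|)
    have a1 := le_abs_self (2 * (s₀.re + ε))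
    have a2 := le_abs_self (2 * (s₀.re - ε))
    have a3 := abs_nonneg (2 * (s₀.re + ε))
    have a4 := abs_nonneg (2 * (s₀.re - ε))
    refine ⟨ε, hε0, N₀, fun y => (2 * Real.pi * ‖y‖) ^ (2 * (s₀.re - ε)) +
      (2 * Real.pi * ‖y‖) ^ (2 * (s₀.re + ε)),
      fun y => by positivity, fun N hN => ?_, fun s hs => ?_, ?_⟩
    · have hN' : (N₀ : ℝ) ≤ N := by exact_mod_cast hN
      simp only [add_mul, Real.mul_rpow Real.two_pi_pos.le (norm_nonneg _), mul_assoc _ _ (weight N _)]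
      exact ((integrable_norm_rpow_mul_weight (by linarith) (by linarith)).const_mul _).add
        ((integrable_norm_rpow_mul_weight (by linarith) (by linarith)).const_mul _)
    · linarith [(abs_lt.1 (hre hs)).1]
    · filter_upwards [Measure.ae_ne volume 0] with y hy s hs
      have h0 : 0 < 2 * Real.pi * ‖y‖ := mul_pos Real.two_pi_pos (norm_pos_iff.2 hy)
      have h1 := abs_lt.1 (hre hs)
      simp only [kern, cond_true]
      rw [norm_mul, Circle.norm_coe, one_mul, Complex.norm_cpow_eq_rpow_re_of_pos h0]
      have : (2 * s).re = 2 * s.re := by simp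
      rw [this]
      exact rpow_le_add_rpow h0 (by linarith) (by linarith)

lemma exists_kern_integrable {D : ℕ} [NeZero D] (b : Bool) {s : ℂ} (hs : s ∈ kernDomain D b)
    (x : Space D) : ∃ N₀ : ℕ, ∀ N, N₀ ≤ N → Integrable fun y => ‖kern b s x y‖ * weight N y := by
  obtain ⟨ε, hε, N₀, β, hβ, hint, -, hle⟩ := exists_kern_bound b hs x
  refine ⟨N₀, fun N hN => (hint N hN).mono' (Measurable.aestronglyMeasurable (by fun_prop)) ?_⟩
  filter_upwards [hle] with y hy
  have := weight_pos N y
  rw [Real.norm_of_nonneg (by positivity)]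
  gcongr
  exact hy s (Metric.mem_ball_self hε)

/-- The only poles of `a(-s)` are those of `Γ(D/2 + s)`, since `1/Γ(-s)` is entire; the convention
`0⁻¹ = 0` gives it the right value at the poles of `Γ(-s)`. -/
lemma differentiableAt_kernCoeff {D : ℕ} {b : Bool} {s : ℂ} (hs : ∀ n : ℕ, s ≠ -((D : ℂ) / 2 + n)) :
    DifferentiableAt ℂ (kernCoeff D b) s := by
  cases b
  · have h1 : DifferentiableAt ℂ (fun s => Complex.Gamma ((D : ℂ) / 2 - -s)) s := by
      refine (Complex.differentiableAt_Gamma _ fun m h => hs m ?_).comp s (by fun_prop)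
      linear_combination h
    have h2 : DifferentiableAt ℂ (fun s : ℂ => (Complex.Gamma (-s))⁻¹) s :=
      (Complex.differentiable_one_div_Gamma _).comp s (by fun_prop)
    have h3 : DifferentiableAt ℂ
        (fun s : ℂ => ((2 : ℂ) ^ (2 * -s) * (Real.pi : ℂ) ^ ((D : ℂ) / 2))⁻¹) s := by
      refine DifferentiableAt.inv ((DifferentiableAt.const_cpow (by fun_prop)
        (Or.inl two_ne_zero)).mul_const _) ?_
      simp [Complex.cpow_eq_zero_iff, Real.pi_ne_zero]
    refine ((h1.mul h3).mul h2).congr_of_eventuallyEq (Eventually.of_forall fun s => ?_)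
    simp only [kernCoeff, cond_false, aCoeff, div_eq_mul_inv, Pi.mul_apply]
    rw [mul_inv (_ * _), mul_assoc]
  · exact differentiableAt_const _

lemma norm_integral_mul_le {D : ℕ} {N : ℕ} {k H : Space D → ℂ} {β : Space D → ℝ} {C : ℝ}
    (hk : ∀ᵐ y, ‖k y‖ ≤ β y) (hi : Integrable fun y => β y * weight N y)
    (hH : ∀ y, ‖H y‖ ≤ C * weight N y) : ‖∫ y, k y * H y‖ ≤ C * ∫ y, β y * weight N y := by
  rw [← integral_const_mul]
  refine norm_integral_le_of_norm_le (hi.const_mul C) ?_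
  filter_upwards [hk] with y hy
  rw [norm_mul, mul_left_comm]
  exact mul_le_mul hy (hH y) (norm_nonneg _) ((norm_nonneg _).trans hy)

lemma transf_integral {D : ℕ} (b : Bool) {k : Space D → ℂ} {G : Space D → Space D → ℂ}
    (hi : Integrable fun p : Space D × Space D => k p.1 * G p.1 p.2) (y₂ : Space D) :
    transf b (fun z₂ => ∫ y₁, k y₁ * G y₁ z₂) y₂ = ∫ y₁, k y₁ * transf b (G y₁) y₂ := by
  cases b
  · rfl
  · simp only [transf, cond_true, Real.fourier_eq, Circle.smul_def, smul_eq_mul,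
      ← integral_const_mul]
    rw [integral_integral_swap]
    · simp only [mul_left_comm]
    · have h1 : Continuous fun p : Space D × Space D => (𝐞 (-inner ℝ p.1 y₂) : ℂ) := by fun_prop
      refine hi.swap.norm.mono' (h1.aestronglyMeasurable.mul hi.swap.aestronglyMeasurable)
        (Eventually.of_forall fun p => ?_)
      simp [Function.uncurry, Circle.norm_coe]

lemma transf₂_eq_transf {D : ℕ} (b₁ b₂ : Bool) (G : Space D → Space D → ℂ) (y₁ y₂ : Space D) :
    transf b₂ (fun z₂ => transf₂ b₁ false G y₁ z₂) y₂ = transf₂ b₁ b₂ G y₁ y₂ := rfl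

/-- The product of powers of the two momenta on a smooth family, as an iterated integral. -/
theorem IsSmoothFamily.p2Pow_p1Pow {D : ℕ} [NeZero D] {K : Set (Space D × Space D)}
    {F : ℂ × Space D × Space D → ℂ} (hF : IsSmoothFamily K F) (hK : IsCompact K) (b₁ b₂ : Bool)
    {s t : ℂ} (hs : s ∈ kernDomain D b₁) (ht : t ∈ kernDomain D b₂) (u : ℂ) (x₁ x₂ : Space D) :
    p2Pow t (p1Pow s fun y₁ y₂ => F (u, y₁, y₂)) x₁ x₂ =
      kernCoeff D b₂ t * (kernCoeff D b₁ s * ∫ y₂, kern b₂ t x₂ y₂ * ∫ y₁, kern b₁ s x₁ y₁ *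
        transf₂ b₁ b₂ (fun y₁ y₂ => F (u, y₁, y₂)) y₁ y₂) := by
  obtain ⟨N₁, hN₁⟩ := exists_kern_integrable b₁ hs x₁
  set N := max D N₁ with hN
  have hDN : D ≤ N := le_max_left _ _
  have hk := hN₁ N (le_max_right _ _)
  -- All four bounds are collected because `pPow_eq_integral_kern` asks for decay of a function and
  -- of its transform, whichever representation is chosen.
  have hb : ∀ b₁ b₂, ∃ C, 0 ≤ C ∧ ∀ y₁ y₂,
      ‖transf₂ b₁ b₂ (fun y₁ y₂ => F (u, y₁, y₂)) y₁ y₂‖ ≤ C * weight N y₁ * weight N y₂ := by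
    intro b₁ b₂
    obtain ⟨C, hC0, hC⟩ := hF.exists_norm_transf₂_le hK b₁ b₂ hDN ‖u‖
    exact ⟨C, hC0, hC u le_rfl⟩
  choose C hC0 hC using hb
  have hcomm : ∀ {b₁ b₂ y₁ y₂}, ‖transf₂ b₁ b₂ (fun y₁ y₂ => F (u, y₁, y₂)) y₁ y₂‖ ≤
      C b₁ b₂ * weight N y₂ * weight N y₁ := fun {b₁ b₂ y₁ y₂} =>
    (hC b₁ b₂ y₁ y₂).trans_eq (by ring)
  have hmeas := stronglyMeasurable_transf₂ b₁ false (hF.stronglyMeasurable u)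
  have h1 : ∀ z₂, p1Pow s (fun y₁ y₂ => F (u, y₁, y₂)) x₁ z₂ = kernCoeff D b₁ s *
      ∫ y₁, kern b₁ s x₁ y₁ * transf₂ b₁ false (fun y₁ y₂ => F (u, y₁, y₂)) y₁ z₂ := by
    intro z₂
    refine pPow_eq_integral_kern b₁ hs hDN
      (C := (C false false + C true false) * weight N z₂) ?_ (fun b y => ?_) x₁
    · exact ((hF.stronglyMeasurable u).comp_measurable (g := fun z₁ => (z₁, z₂))
        (by fun_prop)).aestronglyMeasurable
    · have h3 := weight_pos N y
      have h4 := weight_pos N z₂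
      have h5 := hC0 false false
      have h6 := hC0 true false
      refine (hcomm (b₁ := b) (b₂ := false) (y₁ := y) (y₂ := z₂)).trans ?_
      gcongr
      cases b <;> linarith
  have hprod : Integrable fun p : Space D × Space D => kern b₁ s x₁ p.1 *
      transf₂ b₁ false (fun y₁ y₂ => F (u, y₁, y₂)) p.1 p.2 := by
    refine ((hk.mul_prod (integrable_weight hDN)).const_mul (C b₁ false)).mono'
      (AEStronglyMeasurable.mul (Measurable.aestronglyMeasurable (by fun_prop))
        hmeas.aestronglyMeasurable) (Eventually.of_forall fun p => ?_)
    rw [norm_mul]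
    calc _ ≤ ‖kern b₁ s x₁ p.1‖ * (C b₁ false * weight N p.1 * weight N p.2) := by
          gcongr
          exact hC b₁ false p.1 p.2
      _ = _ := by ring
  have htr : ∀ b y₂, transf b (fun z₂ => kernCoeff D b₁ s *
      ∫ y₁, kern b₁ s x₁ y₁ * transf₂ b₁ false (fun y₁ y₂ => F (u, y₁, y₂)) y₁ z₂) y₂ =
      kernCoeff D b₁ s * ∫ y₁, kern b₁ s x₁ y₁ *
        transf₂ b₁ b (fun y₁ y₂ => F (u, y₁, y₂)) y₁ y₂ := by
    intro b y₂
    rw [transf_const_mul, transf_integral b hprod]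
    simp only [transf₂_eq_transf]
  rw [p2Pow]
  simp only [h1]
  rw [pPow_eq_integral_kern b₂ ht hDN (C := ‖kernCoeff D b₁ s‖ *
    ((C b₁ false + C b₁ true) * ∫ y, ‖kern b₁ s x₁ y‖ * weight N y)) ?_ fun b y₂ => ?_]
  · rw [← integral_const_mul (kernCoeff D b₁ s)]
    simp only [htr, mul_left_comm _ (kernCoeff D b₁ s)]
  · refine AEStronglyMeasurable.const_mul (StronglyMeasurable.aestronglyMeasurable ?_) _
    exact StronglyMeasurable.integral_prod_left' (f := fun p : Space D × Space D => kern b₁ s x₁ p.1 *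
      transf₂ b₁ false (fun y₁ y₂ => F (u, y₁, y₂)) p.1 p.2)
      (StronglyMeasurable.mul (Measurable.stronglyMeasurable (by fun_prop)) hmeas)
  · rw [htr, norm_mul, mul_assoc]
    gcongr
    refine (norm_integral_mul_le (Eventually.of_forall fun _ => le_rfl) hk
      fun y => hcomm).trans ?_
    have h3 : 0 ≤ ∫ y, ‖kern b₁ s x₁ y‖ * weight N y :=
      integral_nonneg fun y => mul_nonneg (norm_nonneg _) (weight_pos N y).le
    have h4 := weight_pos N y₂
    have h5 := hC0 b₁ false
    have h6 := hC0 b₁ true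
    rw [mul_right_comm]
    refine mul_le_mul_of_nonneg_right (mul_le_mul_of_nonneg_right ?_ h3) h4.le
    cases b <;> linarith

lemma differentiableOn_integral_kern {D : ℕ} [NeZero D] {b : Bool} {c u₀ : ℂ} {ε C : ℝ} {N : ℕ}
    {x : Space D} {β : Space D → ℝ} (hi : Integrable fun y => β y * weight N y)
    (hβ : ∀ᵐ y, ∀ s ∈ Metric.ball (u₀ + c) ε, ‖kern b s x y‖ ≤ β y) {H : ℂ → Space D → ℂ}
    (hm : ∀ u, AEStronglyMeasurable (H u)) (hd : ∀ y, DifferentiableOn ℂ (H · y) (Metric.ball u₀ ε))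
    (hC : ∀ u ∈ Metric.ball u₀ ε, ∀ y, ‖H u y‖ ≤ C * weight N y) :
    DifferentiableOn ℂ (fun u => ∫ y, kern b (u + c) x y * H u y) (Metric.ball u₀ ε) := by
  have hmem : ∀ u ∈ Metric.ball u₀ ε, u + c ∈ Metric.ball (u₀ + c) ε := by
    intro u hu
    simpa using hu
  refine differentiableOn_integral_of_dominated Metric.isOpen_ball
    (fun u _ => (Measurable.aestronglyMeasurable (by fun_prop)).mul (hm u)) (hi.const_mul C) ?_ ?_
  · filter_upwards [hβ] with y hy u hu
    have h1 := hy _ (hmem u hu)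
    rw [norm_mul, mul_left_comm]
    exact mul_le_mul h1 (hC u hu y) (norm_nonneg _) ((norm_nonneg _).trans h1)
  · filter_upwards [ae_differentiable_kern b x] with y hy
    exact ((hy.comp (by fun_prop : Differentiable ℂ fun u : ℂ => u + c)).differentiableOn).mul (hd y)

/-- The two open half-planes overlap because `D > 0`, so every parameter has a usable
representation. -/
lemma exists_mem_kernDomain (D : ℕ) [NeZero D] (s : ℂ) : ∃ b, s ∈ kernDomain D b := by
  have hD : (0 : ℝ) < D := by exact_mod_cast NeZero.pos D
  by_cases h : s.re < 0
  · exact ⟨false, h⟩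
  · refine ⟨true, ?_⟩
    simp only [kernDomain, cond_true, Set.mem_ofPred_eq]
    linarith

/-- A representation is fixed for each momentum near `u₀`, and holomorphy is carried through the
`y₁`-integral and then the `y₂`-integral by domination. The conditions `hs` and `ht` serve only the
normalizing coefficients. -/
theorem IsSmoothFamily.differentiableAt_p2Pow_p1Pow {D : ℕ} [NeZero D]
    {K : Set (Space D × Space D)} {F : ℂ × Space D × Space D → ℂ} (hF : IsSmoothFamily K F)
    (hK : IsCompact K) (hd : ∀ y, Differentiable ℂ fun u => F (u, y)) {c c' u₀ : ℂ}
    (hs : ∀ n : ℕ, u₀ + c ≠ -((D : ℂ) / 2 + n)) (ht : ∀ n : ℕ, u₀ + c' ≠ -((D : ℂ) / 2 + n))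
    (x₁ x₂ : Space D) :
    DifferentiableAt ℂ (fun u => p2Pow (u + c') (p1Pow (u + c) fun y₁ y₂ => F (u, y₁, y₂)) x₁ x₂)
      u₀ := by
  obtain ⟨b₁, hb₁⟩ := exists_mem_kernDomain D (u₀ + c)
  obtain ⟨b₂, hb₂⟩ := exists_mem_kernDomain D (u₀ + c')
  obtain ⟨ε₁, hε₁, N₁, β₁, hβ₁, hint₁, hdom₁, hle₁⟩ := exists_kern_bound b₁ hb₁ x₁
  obtain ⟨ε₂, hε₂, N₂, β₂, hβ₂, hint₂, hdom₂, hle₂⟩ := exists_kern_bound b₂ hb₂ x₂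
  set ε := min ε₁ ε₂ with hε
  have hε0 : 0 < ε := lt_min hε₁ hε₂
  set N := max D (max N₁ N₂) with hN
  have hDN : D ≤ N := le_max_left _ _
  have hi₁ := hint₁ N ((le_max_left _ _).trans (le_max_right _ _))
  have hi₂ := hint₂ N ((le_max_right _ _).trans (le_max_right _ _))
  have hball : ∀ {u d : ℂ} {ε' : ℝ}, ε ≤ ε' → u ∈ Metric.ball u₀ ε →
      u + d ∈ Metric.ball (u₀ + d) ε' := by
    intro u d ε' h hu
    have := Metric.ball_subset_ball h hu
    simpa using this
  have hle₁' : ∀ᵐ y, ∀ s ∈ Metric.ball (u₀ + c) ε, ‖kern b₁ s x₁ y‖ ≤ β₁ y := by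
    filter_upwards [hle₁] with y hy s hs
    exact hy s (Metric.ball_subset_ball (min_le_left _ _) hs)
  have hle₂' : ∀ᵐ y, ∀ s ∈ Metric.ball (u₀ + c') ε, ‖kern b₂ s x₂ y‖ ≤ β₂ y := by
    filter_upwards [hle₂] with y hy s hs
    exact hy s (Metric.ball_subset_ball (min_le_right _ _) hs)
  obtain ⟨C, hC0, hC⟩ := hF.exists_norm_transf₂_le hK b₁ b₂ hDN (‖u₀‖ + ε)
  have hC' : ∀ u ∈ Metric.ball u₀ ε, ∀ y₁ y₂,
      ‖transf₂ b₁ b₂ (fun y₁ y₂ => F (u, y₁, y₂)) y₁ y₂‖ ≤ C * weight N y₂ * weight N y₁ := by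
    intro u hu y₁ y₂
    refine (hC u ?_ y₁ y₂).trans_eq (by ring)
    have h1 : ‖u - u₀‖ < ε := by rwa [← dist_eq_norm]
    have h2 : ‖u‖ ≤ ‖u₀‖ + ‖u - u₀‖ := by
      simpa using norm_add_le u₀ (u - u₀)
    linarith
  have hmeas : ∀ u, StronglyMeasurable
      (Function.uncurry (transf₂ b₁ b₂ fun y₁ y₂ => F (u, y₁, y₂))) := fun u =>
    stronglyMeasurable_transf₂ b₁ b₂ (hF.stronglyMeasurable u)
  have hinner : ∀ y₂, DifferentiableOn ℂ (fun u => ∫ y₁, kern b₁ (u + c) x₁ y₁ *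
      transf₂ b₁ b₂ (fun y₁ y₂ => F (u, y₁, y₂)) y₁ y₂) (Metric.ball u₀ ε) := by
    intro y₂
    refine differentiableOn_integral_kern hi₁ hle₁'
      (H := fun u y₁ => transf₂ b₁ b₂ (fun y₁ y₂ => F (u, y₁, y₂)) y₁ y₂) (fun u => ?_)
      (fun y₁ => (hF.differentiable_transf₂ hK hd b₁ b₂ y₁ y₂).differentiableOn)
      (fun u hu y₁ => hC' u hu y₁ y₂)
    exact ((hmeas u).comp_measurable (g := fun y₁ => (y₁, y₂)) (by fun_prop)).aestronglyMeasurable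
  have houter : DifferentiableOn ℂ (fun u => ∫ y₂, kern b₂ (u + c') x₂ y₂ *
      ∫ y₁, kern b₁ (u + c) x₁ y₁ * transf₂ b₁ b₂ (fun y₁ y₂ => F (u, y₁, y₂)) y₁ y₂)
      (Metric.ball u₀ ε) := by
    refine differentiableOn_integral_kern (C := C * ∫ y, β₁ y * weight N y) hi₂ hle₂'
      (H := fun u y₂ => ∫ y₁, kern b₁ (u + c) x₁ y₁ *
        transf₂ b₁ b₂ (fun y₁ y₂ => F (u, y₁, y₂)) y₁ y₂) (fun u => ?_) hinner fun u hu y₂ => ?_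
    · refine StronglyMeasurable.aestronglyMeasurable ?_
      exact StronglyMeasurable.integral_prod_left' (f := fun p : Space D × Space D =>
        kern b₁ (u + c) x₁ p.1 * transf₂ b₁ b₂ (fun y₁ y₂ => F (u, y₁, y₂)) p.1 p.2)
        (StronglyMeasurable.mul (Measurable.stronglyMeasurable (by fun_prop)) (hmeas u))
    · refine (norm_integral_mul_le (hle₁'.mono fun y hy => hy _ (hball le_rfl hu)) hi₁
        fun y₁ => hC' u hu y₁ y₂).trans_eq ?_
      ring
  have hnhds := Metric.ball_mem_nhds u₀ hε0
  have hcoef₁ : DifferentiableAt ℂ (fun u => kernCoeff D b₁ (u + c)) u₀ :=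
    DifferentiableAt.comp (g := kernCoeff D b₁) (f := fun u => u + c) u₀
      (differentiableAt_kernCoeff hs) (by fun_prop)
  have hcoef₂ : DifferentiableAt ℂ (fun u => kernCoeff D b₂ (u + c')) u₀ :=
    DifferentiableAt.comp (g := kernCoeff D b₂) (f := fun u => u + c') u₀
      (differentiableAt_kernCoeff ht) (by fun_prop)
  refine (hcoef₂.mul (hcoef₁.mul (houter.differentiableAt hnhds))).congr_of_eventuallyEq ?_
  filter_upwards [hnhds] with u hu
  exact hF.p2Pow_p1Pow hK b₁ b₂ (hdom₁ _ (hball (min_le_left _ _) hu))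
    (hdom₂ _ (hball (min_le_right _ _) hu)) u x₁ x₂

/-- Near the support `y₁ ≠ y₂`, so the power is `exp(2(u + c) log |y₁ - y₂|)`, smooth jointly in `u`
and `y`; near other points the product vanishes. -/
lemma IsTest.isSmoothFamily_q12Pow {D : ℕ} {f : Space D → Space D → ℂ} (hf : IsTest f) (c : ℂ) :
    IsSmoothFamily (tsupport fun z : Space D × Space D => f z.1 z.2)
      (fun z => q12Pow (z.1 + c) f z.2.1 z.2.2) where
  eq_zero z hz := by
    have : f z.2.1 z.2.2 = 0 := image_eq_zero_of_notMem_tsupport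
      (f := fun z : Space D × Space D => f z.1 z.2) hz
    simp [q12Pow, this]
  contDiff := by
    rw [contDiff_iff_contDiffAt]
    intro z
    by_cases hz : z.2 ∈ tsupport fun z : Space D × Space D => f z.1 z.2
    · have hne : z.2.1 - z.2.2 ≠ 0 := sub_ne_zero.2 (hf.off_diag _ hz)
      have hcont : Continuous fun z : ℂ × Space D × Space D => z.2.1 - z.2.2 := by fun_prop
      have hev : (fun z : ℂ × Space D × Space D => q12Pow (z.1 + c) f z.2.1 z.2.2) =ᶠ[𝓝 z]
          fun z => Complex.exp ((Real.log ‖z.2.1 - z.2.2‖ : ℝ) * (2 * (z.1 + c))) *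
            f z.2.1 z.2.2 := by
        filter_upwards [hcont.continuousAt.eventually_ne hne] with w hw
        have h0 : ((‖w.2.1 - w.2.2‖ : ℝ) : ℂ) ≠ 0 := by simpa using hw
        rw [q12Pow, Complex.cpow_def_of_ne_zero h0, Complex.ofReal_log (norm_nonneg _)]
      refine ContDiffAt.congr_of_eventuallyEq ?_ hev
      refine ContDiffAt.mul (ContDiffAt.cexp (ContDiffAt.mul ?_ ?_)) ?_
      · refine Complex.ofRealCLM.contDiff.contDiffAt.comp z ?_
        exact ((contDiffAt_norm ℝ hne).comp z (by fun_prop)).log (norm_ne_zero_iff.2 hne)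
      · fun_prop
      · exact (hf.smooth.comp contDiff_snd).contDiffAt
    · refine (contDiffAt_const (c := (0 : ℂ))).congr_of_eventuallyEq ?_
      filter_upwards [((isClosed_tsupport _).isOpen_compl.preimage continuous_snd).mem_nhds hz]
        with w hw
      have : f w.2.1 w.2.2 = 0 := image_eq_zero_of_notMem_tsupport
        (f := fun z : Space D × Space D => f z.1 z.2) hw
      simp [q12Pow, this]

/-- On test functions the operator `R` depends holomorphically on the spectral parameter. -/
theorem IsTest.differentiableAt_ROp {D : ℕ} [NeZero D] {f : Space D → Space D → ℂ} (hf : IsTest f)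
    (Δ₁ Δ₂ : ℂ) {u₀ : ℂ} (hs : ∀ n : ℕ, u₀ + (Δ₂ - Δ₁) / 2 ≠ -((D : ℂ) / 2 + n))
    (ht : ∀ n : ℕ, u₀ + (Δ₁ - Δ₂) / 2 ≠ -((D : ℂ) / 2 + n)) {x₁ x₂ : Space D} (hx : x₁ ≠ x₂) :
    DifferentiableAt ℂ (fun u => ROp Δ₁ Δ₂ u f x₁ x₂) u₀ := by
  have hF := hf.isSmoothFamily_q12Pow ((Δ₁ + Δ₂ - (D : ℂ)) / 2)
  have hd : ∀ y : Space D × Space D, Differentiable ℂ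
      fun u => q12Pow (u + (Δ₁ + Δ₂ - (D : ℂ)) / 2) f y.1 y.2 := by
    intro y
    by_cases hy : y ∈ tsupport fun z : Space D × Space D => f z.1 z.2
    · have h0 : ((‖y.1 - y.2‖ : ℝ) : ℂ) ≠ 0 := by
        simpa using sub_ne_zero.2 (hf.off_diag _ hy)
      exact fun u => (DifferentiableAt.const_cpow (by fun_prop) (Or.inl h0)).mul_const _
    · have : f y.1 y.2 = 0 := image_eq_zero_of_notMem_tsupport
        (f := fun z : Space D × Space D => f z.1 z.2) hy
      simp [q12Pow, this]
  -- The points are exchanged because of the permutation in `ROp`.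
  have h1 := hF.differentiableAt_p2Pow_p1Pow hf.compact hd hs ht x₂ x₁
  have h0 : ((‖x₂ - x₁‖ : ℝ) : ℂ) ≠ 0 := by simpa using sub_ne_zero.2 hx.symm
  exact (DifferentiableAt.const_cpow (by fun_prop) (Or.inl h0)).mul h1

/-! ### Conformal geometry on the light cone -/

/-- The invariant bilinear form of the conformal group. -/
def mink {D : ℕ} (v w : Fin D ⊕ Fin 2 → ℝ) : ℝ := v ⬝ᵥ (eta D *ᵥ w)

lemma mink_apply {D : ℕ} (v w : Fin D ⊕ Fin 2 → ℝ) : mink v w =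
    ∑ i, v (Sum.inl i) * w (Sum.inl i) + v (Sum.inr 0) * w (Sum.inr 0) -
      v (Sum.inr 1) * w (Sum.inr 1) := by
  simp [mink, eta, dotProduct, Matrix.mulVec_diagonal, Fintype.sum_sum_type, Fin.sum_univ_two]
  ring

lemma mink_mulVec {D : ℕ} {g : GL (Fin D ⊕ Fin 2) ℝ} (hg : g ∈ conformalGroup D)
    (v w : Fin D ⊕ Fin 2 → ℝ) : mink (g.1 *ᵥ v) (g.1 *ᵥ w) = mink v w := by
  have h : (g.1)ᵀ * eta D * g.1 = eta D := hg
  unfold mink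
  rw [Matrix.mulVec_mulVec, Matrix.dotProduct_mulVec, ← Matrix.vecMul_transpose,
    Matrix.vecMul_vecMul, ← Matrix.mul_assoc, h, ← Matrix.dotProduct_mulVec]

/-- Through this formula, invariance of the bilinear form becomes covariance of distances. -/
lemma mink_lift {D : ℕ} (x y : Space D) : mink (lift x) (lift y) = -(‖x - y‖ ^ 2 / 2) := by
  have h : ∑ i, x i * y i = inner ℝ x y := by
    rw [PiLp.inner_apply]
    simp [mul_comm]
  rw [mink_apply]
  simp only [lift, Sum.elim_inl, Sum.elim_inr, h, Matrix.cons_val_zero, Matrix.cons_val_one]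
  rw [@norm_sub_sq_real]
  ring

lemma lift_sum {D : ℕ} (x : Space D) : lift x (Sum.inr 0) + lift x (Sum.inr 1) = 1 := by
  simp [lift]
  ring

lemma factor_eq_of_mulVec {D : ℕ} {g : GL (Fin D ⊕ Fin 2) ℝ} {x y : Space D} {c : ℝ}
    (h : g.1 *ᵥ lift x = c • lift y) : factor g x = c := by
  rw [factor, h, Pi.smul_apply, Pi.smul_apply, ← smul_add, lift_sum, smul_eq_mul, mul_one]

lemma act_eq_of_mulVec {D : ℕ} {g : GL (Fin D ⊕ Fin 2) ℝ} {x y : Space D} {c : ℝ} (hc : c ≠ 0)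
    (h : g.1 *ᵥ lift x = c • lift y) : act g x = y := by
  ext i
  simp only [act, factor_eq_of_mulVec h, h]
  simp [lift, hc]

/-- The image of a lift is a null vector, and a null vector whose last two coordinates have sum `Ω ≠
0` is `Ω` times a lift: nullness determines their difference from the first `D` coordinates. -/
lemma mulVec_lift {D : ℕ} {g : GL (Fin D ⊕ Fin 2) ℝ} (hg : g ∈ conformalGroup D) {x : Space D}
    (hx : factor g x ≠ 0) : g.1 *ᵥ lift x = factor g x • lift (act g x) := by
  have hnull : mink (g.1 *ᵥ lift x) (g.1 *ᵥ lift x) = 0 := by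
    rw [mink_mulVec hg, mink_lift]
    simp
  have hΩ : factor g x = (g.1 *ᵥ lift x) (Sum.inr 0) + (g.1 *ᵥ lift x) (Sum.inr 1) := rfl
  have hnorm : ‖act g x‖ ^ 2 = ((g.1 *ᵥ lift x) (Sum.inr 1) - (g.1 *ᵥ lift x) (Sum.inr 0)) /
      factor g x := by
    rw [EuclideanSpace.real_norm_sq_eq]
    simp only [act, mul_pow, ← Finset.mul_sum]
    rw [mink_apply] at hnull
    have : ∑ i, (g.1 *ᵥ lift x) (Sum.inl i) ^ 2 =
        ((g.1 *ᵥ lift x) (Sum.inr 1) - (g.1 *ᵥ lift x) (Sum.inr 0)) * factor g x := by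
      rw [hΩ]
      simp only [sq]
      linear_combination hnull
    rw [this]
    field_simp
  set v := g.1 *ᵥ lift x with hv
  clear_value v
  ext j
  rcases j with i | j
  · simp [lift, act, hx, hv]
  · fin_cases j
    · simp only [lift, Pi.smul_apply, smul_eq_mul, Fin.zero_eta, Sum.elim_inr, Matrix.cons_val_zero,
        hnorm]
      field_simp
      rw [hΩ]
      ring
    · simp only [lift, Pi.smul_apply, smul_eq_mul, Fin.mk_one, Sum.elim_inr, Matrix.cons_val_one,
        hnorm, Matrix.cons_val_fin_one]
      field_simp
      rw [hΩ]
      ring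

lemma inv_mulVec_lift_act {D : ℕ} {g : GL (Fin D ⊕ Fin 2) ℝ} (hg : g ∈ conformalGroup D)
    {x : Space D} (hx : factor g x ≠ 0) :
    (g⁻¹).1 *ᵥ lift (act g x) = (factor g x)⁻¹ • lift x := by
  have h1 : (g⁻¹).1 * g.1 = 1 := g.inv_mul
  have h2 : lift (act g x) = (factor g x)⁻¹ • (g.1 *ᵥ lift x) := by
    rw [mulVec_lift hg hx, smul_smul, inv_mul_cancel₀ hx, one_smul]
  rw [h2, Matrix.mulVec_smul, Matrix.mulVec_mulVec, h1, Matrix.one_mulVec]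

lemma factor_inv_act {D : ℕ} {g : GL (Fin D ⊕ Fin 2) ℝ} (hg : g ∈ conformalGroup D)
    {x : Space D} (hx : factor g x ≠ 0) : factor g⁻¹ (act g x) = (factor g x)⁻¹ :=
  factor_eq_of_mulVec (inv_mulVec_lift_act hg hx)

lemma act_inv_act {D : ℕ} {g : GL (Fin D ⊕ Fin 2) ℝ} (hg : g ∈ conformalGroup D)
    {x : Space D} (hx : factor g x ≠ 0) : act g⁻¹ (act g x) = x :=
  act_eq_of_mulVec (inv_ne_zero hx) (inv_mulVec_lift_act hg hx)

lemma norm_act_sub_sq {D : ℕ} {g : GL (Fin D ⊕ Fin 2) ℝ} (hg : g ∈ conformalGroup D)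
    {x y : Space D} (hx : factor g x ≠ 0) (hy : factor g y ≠ 0) :
    factor g x * factor g y * ‖act g x - act g y‖ ^ 2 = ‖x - y‖ ^ 2 := by
  have h := mink_mulVec hg (lift x) (lift y)
  have e : ∀ (a b : ℝ) (v w : Fin D ⊕ Fin 2 → ℝ), mink (a • v) (b • w) = a * b * mink v w := by
    intro a b v w
    simp only [mink, Matrix.mulVec_smul, smul_dotProduct, dotProduct_smul, smul_eq_mul]
    ring
  rw [mulVec_lift hg hx, mulVec_lift hg hy, e, mink_lift, mink_lift] at h
  linear_combination (-2) * h

lemma act_ne_act {D : ℕ} {g : GL (Fin D ⊕ Fin 2) ℝ} (hg : g ∈ conformalGroup D)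
    {x y : Space D} (hx : factor g x ≠ 0) (hy : factor g y ≠ 0) (h : x ≠ y) :
    act g x ≠ act g y := fun he =>
  h (by rw [← act_inv_act hg hx, he, act_inv_act hg hy])

/-- If `Ω` vanishes at `x`, nullness forces the first `D` coordinates of the image to vanish,
leaving a multiple of `(0, 1, -1)`. Two such images have Minkowski product zero, so the points are
at distance zero. -/
lemma subsingleton_factor_eq_zero {D : ℕ} {g : GL (Fin D ⊕ Fin 2) ℝ} (hg : g ∈ conformalGroup D) :
    {x : Space D | factor g x = 0}.Subsingleton := by
  intro x hx y hy
  have key : ∀ z : Space D, factor g z = 0 → ∀ i, (g.1 *ᵥ lift z) (Sum.inl i) = 0 := by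
    intro z hz i
    have h := mink_mulVec hg (lift z) (lift z)
    rw [mink_lift, mink_apply] at h
    simp only [factor] at hz
    have h2 : ∑ i, (g.1 *ᵥ lift z) (Sum.inl i) ^ 2 = 0 := by
      simp only [sub_self, norm_zero] at h
      simp only [sq]
      linear_combination h - ((g.1 *ᵥ lift z) (Sum.inr 0) - (g.1 *ᵥ lift z) (Sum.inr 1)) * hz
    have h3 := (Finset.sum_eq_zero_iff_of_nonneg fun i _ => sq_nonneg _).1 h2 i (Finset.mem_univ i)
    simpa using h3
  have h := mink_mulVec hg (lift x) (lift y)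
  rw [mink_lift, mink_apply] at h
  simp only [key x hx, zero_mul, Finset.sum_const_zero] at h
  have hx' : (g.1 *ᵥ lift x) (Sum.inr 0) + (g.1 *ᵥ lift x) (Sum.inr 1) = 0 := hx
  have hy' : (g.1 *ᵥ lift y) (Sum.inr 0) + (g.1 *ᵥ lift y) (Sum.inr 1) = 0 := hy
  have h0 : ‖x - y‖ ^ 2 = 0 := by
    linear_combination 2 * h - 2 * (g.1 *ᵥ lift x) (Sum.inr 0) * hy' +
      2 * (g.1 *ᵥ lift y) (Sum.inr 1) * hx'
  exact sub_eq_zero.1 (norm_eq_zero.1 (pow_eq_zero_iff two_ne_zero |>.1 h0))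

lemma ae_factor_ne_zero {D : ℕ} [NeZero D] {g : GL (Fin D ⊕ Fin 2) ℝ} (hg : g ∈ conformalGroup D) :
    ∀ᵐ x : Space D, factor g x ≠ 0 := by
  rw [ae_iff]
  simp only [not_not]
  exact (subsingleton_factor_eq_zero hg).measure_zero _

lemma contDiff_mulVec_lift {D : ℕ} (g : GL (Fin D ⊕ Fin 2) ℝ) (j : Fin D ⊕ Fin 2) :
    ContDiff ℝ ∞ fun x : Space D => (g.1 *ᵥ lift x) j := by
  simp only [Matrix.mulVec, dotProduct]
  refine ContDiff.sum fun i _ => contDiff_const.mul ?_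
  have hn : ContDiff ℝ ∞ fun x : Space D => ‖x‖ ^ 2 := contDiff_norm_sq ℝ
  rcases i with i | i
  · simp only [lift, Sum.elim_inl]
    fun_prop
  · fin_cases i
    · simp only [lift, Fin.zero_eta, Sum.elim_inr, Matrix.cons_val_zero]
      fun_prop
    · simp only [lift, Fin.mk_one, Sum.elim_inr, Matrix.cons_val_one, Matrix.cons_val_fin_one]
      fun_prop

lemma contDiff_factor {D : ℕ} (g : GL (Fin D ⊕ Fin 2) ℝ) :
    ContDiff ℝ ∞ (factor g : Space D → ℝ) :=
  (contDiff_mulVec_lift g _).add (contDiff_mulVec_lift g _)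

lemma differentiableAt_act {D : ℕ} {g : GL (Fin D ⊕ Fin 2) ℝ} {x : Space D} (hx : factor g x ≠ 0) :
    DifferentiableAt ℝ (act g) x := by
  rw [differentiableAt_euclidean]
  intro i
  exact (((contDiff_factor g).differentiable (by simp) x).inv hx).mul
    ((contDiff_mulVec_lift g (Sum.inl i)).differentiable (by simp) x)

/-- Infinitesimal form of `norm_act_sub_sq`: apply it to `x` and `x + τ v`, divide by `τ²` and let
`τ → 0`. So `Ω` times the derivative is an isometry. -/
lemma norm_fderiv_act {D : ℕ} {g : GL (Fin D ⊕ Fin 2) ℝ} (hg : g ∈ conformalGroup D)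
    {x : Space D} (hx : factor g x ≠ 0) (v : Space D) :
    ‖factor g x • fderiv ℝ (act g) x v‖ = ‖v‖ := by
  have h1 := ((differentiableAt_act hx).hasFDerivAt.hasLineDerivAt v).tendsto_slope_zero
  have hcont : Continuous fun τ : ℝ => factor g (x + τ • v) :=
    (contDiff_factor g).continuous.comp (by fun_prop)
  have h2 : Tendsto (fun τ : ℝ => factor g (x + τ • v)) (𝓝[≠] 0) (𝓝 (factor g x)) := by
    have := hcont.tendsto 0
    rw [zero_smul, add_zero] at this
    exact this.mono_left nhdsWithin_le_nhds
  have h3 := (h2.const_mul (factor g x)).mul (h1.norm.pow 2)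
  have h4 : ∀ᶠ τ : ℝ in 𝓝[≠] 0, factor g x * factor g (x + τ • v) *
      ‖τ⁻¹ • (act g (x + τ • v) - act g x)‖ ^ 2 = ‖v‖ ^ 2 := by
    filter_upwards [h2.eventually_ne hx, self_mem_nhdsWithin] with τ hτ hτ0
    have h5 := norm_act_sub_sq hg hx hτ
    have hτ0' : τ ≠ 0 := hτ0
    rw [norm_smul, mul_pow, norm_sub_rev, mul_left_comm, h5]
    simp [norm_smul, mul_pow]
    field_simp
  have h6 := tendsto_nhds_unique (tendsto_const_nhds.congr' (h4.mono fun _ h => h.symm)) h3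
  rw [← sq_eq_sq₀ (norm_nonneg _) (norm_nonneg _), norm_smul, mul_pow, Real.norm_eq_abs, sq_abs, h6]
  ring

lemma abs_det_fderiv_act {D : ℕ} {g : GL (Fin D ⊕ Fin 2) ℝ} (hg : g ∈ conformalGroup D)
    {x : Space D} (hx : factor g x ≠ 0) : |(fderiv ℝ (act g) x).det| = (|factor g x| ^ D)⁻¹ := by
  set L : Space D →ₗᵢ[ℝ] Space D :=
    ⟨factor g x • (fderiv ℝ (act g) x : Space D →ₗ[ℝ] Space D), fun v => norm_fderiv_act hg hx v⟩
    with hL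
  have h1 := L.normDet_eq_one
  rw [hL, LinearMap.normDet_smul, finrank_euclideanSpace_fin, LinearMap.normDet_eq_abs_det,
    Real.norm_eq_abs] at h1
  exact eq_inv_of_mul_eq_one_right h1

/-! ### Change of variables by a conformal transformation -/

/-- The pairs of points at which a conformal transformation is finite. -/
def regularPairs {D : ℕ} (g : GL (Fin D ⊕ Fin 2) ℝ) : Set (Space D × Space D) :=
  {p | factor g p.1 ≠ 0 ∧ factor g p.2 ≠ 0}

lemma ae_mem_regularPairs {D : ℕ} [NeZero D] {g : GL (Fin D ⊕ Fin 2) ℝ} (hg : g ∈ conformalGroup D) :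
    ∀ᵐ p : Space D × Space D, p ∈ regularPairs g :=
  (Measure.quasiMeasurePreserving_fst.ae (ae_factor_ne_zero hg)).and
    (Measure.quasiMeasurePreserving_snd.ae (ae_factor_ne_zero hg))

lemma measurableSet_regularPairs {D : ℕ} (g : GL (Fin D ⊕ Fin 2) ℝ) :
    MeasurableSet (regularPairs g) := by
  have h := (contDiff_factor (D := D) g).continuous
  exact ((isOpen_ne_fun (h.comp continuous_fst) continuous_const).inter
    (isOpen_ne_fun (h.comp continuous_snd) continuous_const)).measurableSet

lemma image_regularPairs {D : ℕ} {g : GL (Fin D ⊕ Fin 2) ℝ} (hg : g ∈ conformalGroup D) :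
    Prod.map (act g) (act g) '' regularPairs g = regularPairs g⁻¹ := by
  have hg' := (conformalGroup D).inv_mem hg
  ext p
  constructor
  · rintro ⟨q, hq, rfl⟩
    refine ⟨?_, ?_⟩
    · rw [Prod.map_fst, factor_inv_act hg hq.1]
      exact inv_ne_zero hq.1
    · rw [Prod.map_snd, factor_inv_act hg hq.2]
      exact inv_ne_zero hq.2
  · rintro ⟨h1, h2⟩
    refine ⟨Prod.map (act g⁻¹) (act g⁻¹) p, ⟨?_, ?_⟩, ?_⟩
    · have := factor_inv_act hg' h1
      rw [inv_inv] at this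
      rw [Prod.map_fst, this]
      exact inv_ne_zero h1
    · have := factor_inv_act hg' h2
      rw [inv_inv] at this
      rw [Prod.map_snd, this]
      exact inv_ne_zero h2
    · have e1 := act_inv_act hg' h1
      have e2 := act_inv_act hg' h2
      rw [inv_inv] at e1 e2
      exact Prod.ext e1 e2

lemma injOn_regularPairs {D : ℕ} {g : GL (Fin D ⊕ Fin 2) ℝ} (hg : g ∈ conformalGroup D) :
    Set.InjOn (Prod.map (act g) (act g)) (regularPairs g) := by
  intro p hp q hq h
  have h1 : act g p.1 = act g q.1 := congrArg Prod.fst h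
  have h2 : act g p.2 = act g q.2 := congrArg Prod.snd h
  refine Prod.ext ?_ ?_
  · rw [← act_inv_act hg hp.1, h1, act_inv_act hg hq.1]
  · rw [← act_inv_act hg hp.2, h2, act_inv_act hg hq.2]

/-- Change of variables by a conformal transformation acting on pairs of points. -/
theorem integrable_and_integral_comp_act {D : ℕ} [NeZero D] {g : GL (Fin D ⊕ Fin 2) ℝ}
    (hg : g ∈ conformalGroup D) (h : Space D × Space D → ℂ) :
    (Integrable h ↔ Integrable fun p : Space D × Space D =>
      ((|factor g p.1| ^ D)⁻¹ * (|factor g p.2| ^ D)⁻¹) • h (act g p.1, act g p.2)) ∧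
    ∫ p, h p = ∫ p : Space D × Space D,
      ((|factor g p.1| ^ D)⁻¹ * (|factor g p.2| ^ D)⁻¹) • h (act g p.1, act g p.2) := by
  have hderiv : ∀ p ∈ regularPairs g, HasFDerivWithinAt (Prod.map (act g) (act g))
      ((fderiv ℝ (act g) p.1).prodMap (fderiv ℝ (act g) p.2)) (regularPairs g) p := fun p hp =>
    (HasFDerivAt.prodMap p (differentiableAt_act hp.1).hasFDerivAt
      (differentiableAt_act hp.2).hasFDerivAt).hasFDerivWithinAt
  have hdet : ∀ p ∈ regularPairs g,
      |((fderiv ℝ (act g) p.1).prodMap (fderiv ℝ (act g) p.2)).det| =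
        (|factor g p.1| ^ D)⁻¹ * (|factor g p.2| ^ D)⁻¹ := by
    intro p hp
    rw [← abs_det_fderiv_act hg hp.1, ← abs_det_fderiv_act hg hp.2, ← abs_mul]
    congr 1
    exact LinearMap.det_prodMap _ _
  have : (volume : Measure (Space D × Space D)).IsAddHaarMeasure :=
    Measure.prod.instIsAddHaarMeasure volume volume
  -- At most one point goes to infinity, so regular pairs have full measure and the restricted
  -- integrals are integrals over the whole space.
  have hr : volume.restrict (regularPairs g) = (volume : Measure (Space D × Space D)) :=
    Measure.restrict_eq_self_of_ae_mem (ae_mem_regularPairs hg)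
  have hr' : volume.restrict (regularPairs g⁻¹) = (volume : Measure (Space D × Space D)) :=
    Measure.restrict_eq_self_of_ae_mem (ae_mem_regularPairs ((conformalGroup D).inv_mem hg))
  have hcongr : (fun p : Space D × Space D =>
      |((fderiv ℝ (act g) p.1).prodMap (fderiv ℝ (act g) p.2)).det| • h (Prod.map (act g) (act g) p))
      =ᵐ[volume] fun p => ((|factor g p.1| ^ D)⁻¹ * (|factor g p.2| ^ D)⁻¹) •
        h (act g p.1, act g p.2) := by
    filter_upwards [ae_mem_regularPairs hg] with p hp
    rw [hdet p hp]
    rfl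
  constructor
  · have h1 := integrableOn_image_iff_integrableOn_abs_det_fderiv_smul
      (volume : Measure (Space D × Space D)) (measurableSet_regularPairs g) hderiv (injOn_regularPairs hg) h
    rw [image_regularPairs hg, IntegrableOn, IntegrableOn, hr, hr'] at h1
    exact h1.trans (integrable_congr hcongr)
  · have h1 := integral_image_eq_integral_abs_det_fderiv_smul
      (volume : Measure (Space D × Space D)) (measurableSet_regularPairs g) hderiv (injOn_regularPairs hg) h
    rw [image_regularPairs hg, hr, hr'] at h1
    exact h1.trans (integral_congr_ae hcongr)

/-- Absolute values make every base in `norm_act_sub_sq` a nonnegative real, for which complex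
powers are multiplicative with no branch ambiguity; `x = y` is allowed. -/
lemma cpow_norm_act_sub {D : ℕ} {g : GL (Fin D ⊕ Fin 2) ℝ} (hg : g ∈ conformalGroup D)
    {x y : Space D} (hx : factor g x ≠ 0) (hy : factor g y ≠ 0) (z : ℂ) :
    ((‖act g x - act g y‖ : ℝ) : ℂ) ^ (2 * z) = ((‖x - y‖ : ℝ) : ℂ) ^ (2 * z) *
      ((|factor g x| : ℝ) : ℂ) ^ (-z) * ((|factor g y| : ℝ) : ℂ) ^ (-z) := by
  have hsq : ∀ a : ℝ, 0 ≤ a → (a : ℂ) ^ (2 * z) = ((a ^ 2 : ℝ) : ℂ) ^ z := by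
    intro a ha
    rw [Complex.ofReal_pow]
    refine Complex.cpow_ofNat_mul' ?_ ?_ z <;> rw [Complex.arg_ofReal_of_nonneg ha] <;>
      simp [Real.pi_pos, Real.pi_pos.le]
  have h1 := norm_act_sub_sq hg hx hy
  have hx' := abs_pos.2 hx
  have hy' := abs_pos.2 hy
  have h2 : ‖x - y‖ ^ 2 = |factor g x| * |factor g y| * ‖act g x - act g y‖ ^ 2 := by
    rw [← abs_of_nonneg (sq_nonneg ‖x - y‖), ← h1, abs_mul, abs_mul, abs_of_nonneg (sq_nonneg ‖_‖)]
  have hx0 : ((|factor g x| : ℝ) : ℂ) ^ z ≠ 0 := by simp [Complex.cpow_eq_zero_iff, hx]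
  have hy0 : ((|factor g y| : ℝ) : ℂ) ^ z ≠ 0 := by simp [Complex.cpow_eq_zero_iff, hy]
  rw [hsq _ (norm_nonneg _), hsq _ (norm_nonneg _), h2, Complex.ofReal_mul,
    Complex.mul_cpow_ofReal_nonneg (by positivity) (by positivity), Complex.ofReal_mul,
    Complex.mul_cpow_ofReal_nonneg hx'.le hy'.le, Complex.cpow_neg, Complex.cpow_neg]
  field_simp

/-! ### Covariance of `R` as an integral operator -/

/-- The integrand in the value of `R` at `(x₁, x₂)` when `R` is an integral operator. -/
noncomputable def integrandR {D : ℕ} (Δ₁ Δ₂ u : ℂ) (f : Space D → Space D → ℂ) (x₁ x₂ : Space D)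
    (y : Space D × Space D) : ℂ :=
  ((‖x₂ - y.1‖ : ℝ) : ℂ) ^ (-(2 * ((D : ℂ) / 2 + (u + (Δ₂ - Δ₁) / 2)))) *
    ((‖x₁ - y.2‖ : ℝ) : ℂ) ^ (-(2 * ((D : ℂ) / 2 + (u + (Δ₁ - Δ₂) / 2)))) *
    (((‖y.1 - y.2‖ : ℝ) : ℂ) ^ (2 * (u + (Δ₁ + Δ₂ - (D : ℂ)) / 2)) * f y.1 y.2)

/-- Absolute convergence enters through Fubini, which merges the iterated integral (`y₁` inside,
`y₂` outside). The permutation pairs `x₂` with `y₁` and `x₁` with `y₂`. -/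
lemma ROp_eq_integral {D : ℕ} {Δ₁ Δ₂ u : ℂ} (hs : (u + (Δ₂ - Δ₁) / 2).re < 0)
    (ht : (u + (Δ₁ - Δ₂) / 2).re < 0) {f : Space D → Space D → ℂ} {x₁ x₂ : Space D}
    (hf : Converges Δ₁ Δ₂ u f x₁ x₂) :
    ROp Δ₁ Δ₂ u f x₁ x₂ = ((‖x₁ - x₂‖ : ℝ) : ℂ) ^ (2 * (u + ((D : ℂ) - Δ₁ - Δ₂) / 2)) *
      (aCoeff D (-(u + (Δ₁ - Δ₂) / 2)) * (aCoeff D (-(u + (Δ₂ - Δ₁) / 2)) *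
        ∫ y, integrandR Δ₁ Δ₂ u f x₁ x₂ y)) := by
  have h := integral_prod_symm (integrandR Δ₁ Δ₂ u f x₁ x₂) hf
  rw [Measure.volume_eq_prod, h]
  simp only [ROp, perm, q12Pow, p2Pow, p1Pow, pPow, if_pos hs, if_pos ht]
  rw [norm_sub_rev, ← integral_const_mul (aCoeff D (-(u + (Δ₂ - Δ₁) / 2)))]
  congr 3
  ext y₂
  rw [mul_left_comm, ← integral_const_mul (((‖x₁ - y₂‖ : ℝ) : ℂ) ^ _)]
  congr 2
  ext y₁
  simp only [integrandR]
  ring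

/-- Covariance of the integrand. -/
lemma integrandR_rho {D : ℕ} (Δ₁ Δ₂ u : ℂ) {g : GL (Fin D ⊕ Fin 2) ℝ}
    (hg : g ∈ conformalGroup D) (f : Space D → Space D → ℂ) {x₁ x₂ : Space D}
    (hx₁ : factor g⁻¹ x₁ ≠ 0) (hx₂ : factor g⁻¹ x₂ ≠ 0) {y : Space D × Space D}
    (hy : y ∈ regularPairs g⁻¹) :
    integrandR Δ₁ Δ₂ u (rho Δ₁ Δ₂ g f) x₁ x₂ y =
      (((|factor g⁻¹ x₂| : ℝ) : ℂ) ^ (-((D : ℂ) / 2 + (u + (Δ₂ - Δ₁) / 2))) *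
        ((|factor g⁻¹ x₁| : ℝ) : ℂ) ^ (-((D : ℂ) / 2 + (u + (Δ₁ - Δ₂) / 2)))) *
      (((|factor g⁻¹ y.1| ^ D)⁻¹ * (|factor g⁻¹ y.2| ^ D)⁻¹) •
        integrandR Δ₁ Δ₂ u f (act g⁻¹ x₁) (act g⁻¹ x₂) (act g⁻¹ y.1, act g⁻¹ y.2)) := by
  have hg' := (conformalGroup D).inv_mem hg
  obtain ⟨hy₁, hy₂⟩ := hy
  simp only [integrandR, rho, Complex.real_smul]
  simp only [← mul_neg]
  rw [cpow_norm_act_sub hg' hx₂ hy₁, cpow_norm_act_sub hg' hx₁ hy₂, cpow_norm_act_sub hg' hy₁ hy₂]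
  have ha₁ : ((|factor g⁻¹ y.1| : ℝ) : ℂ) ≠ 0 := by simpa using hy₁
  have ha₂ : ((|factor g⁻¹ y.2| : ℝ) : ℂ) ≠ 0 := by simpa using hy₂
  have hb₁ : ((|factor g⁻¹ x₁| : ℝ) : ℂ) ≠ 0 := by simpa using hx₁
  have hb₂ : ((|factor g⁻¹ x₂| : ℝ) : ℂ) ≠ 0 := by simpa using hx₂
  push_cast
  generalize ((|factor g⁻¹ y.1| : ℝ) : ℂ) = a₁ at *
  generalize ((|factor g⁻¹ y.2| : ℝ) : ℂ) = a₂ at *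
  generalize ((|factor g⁻¹ x₁| : ℝ) : ℂ) = b₁ at *
  generalize ((|factor g⁻¹ x₂| : ℝ) : ℂ) = b₂ at *
  -- Power counting at `y₁`, with `s = u + (Δ₂ - Δ₁)/2`: `-Δ₁ = -D + (D/2 + s) - (u + (Δ₁ + Δ₂ -
  -- D)/2)`, from the Jacobian, the `p₁` kernel and `q₁₂`. The count at `y₂` is the same with the
  -- indices exchanged.
  have e₁ : a₁ ^ (-Δ₁) = (a₁ ^ D)⁻¹ * (a₁ ^ (- -((D : ℂ) / 2 + (u + (Δ₂ - Δ₁) / 2))) *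
      a₁ ^ (-(u + (Δ₁ + Δ₂ - (D : ℂ)) / 2))) := by
    rw [← Complex.cpow_natCast, ← Complex.cpow_neg, ← Complex.cpow_add _ _ ha₁,
      ← Complex.cpow_add _ _ ha₁]
    congr 1
    ring
  have e₂ : a₂ ^ (-Δ₂) = (a₂ ^ D)⁻¹ * (a₂ ^ (- -((D : ℂ) / 2 + (u + (Δ₁ - Δ₂) / 2))) *
      a₂ ^ (-(u + (Δ₁ + Δ₂ - (D : ℂ)) / 2))) := by
    rw [← Complex.cpow_natCast, ← Complex.cpow_neg, ← Complex.cpow_add _ _ ha₂,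
      ← Complex.cpow_add _ _ ha₂]
    congr 1
    ring
  have e₃ : b₁ ^ (-((D : ℂ) / 2 + (u + (Δ₁ - Δ₂) / 2))) *
      b₁ ^ (- -((D : ℂ) / 2 + (u + (Δ₁ - Δ₂) / 2))) = 1 := by
    rw [← Complex.cpow_add _ _ hb₁, add_neg_cancel, Complex.cpow_zero]
  have e₄ : b₂ ^ (-((D : ℂ) / 2 + (u + (Δ₂ - Δ₁) / 2))) *
      b₂ ^ (- -((D : ℂ) / 2 + (u + (Δ₂ - Δ₁) / 2))) = 1 := by
    rw [← Complex.cpow_add _ _ hb₂, add_neg_cancel, Complex.cpow_zero]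
  rw [e₁, e₂]
  generalize b₁ ^ (-((D : ℂ) / 2 + (u + (Δ₁ - Δ₂) / 2))) = p₁ at *
  generalize b₁ ^ (- -((D : ℂ) / 2 + (u + (Δ₁ - Δ₂) / 2))) = q₁ at *
  generalize b₂ ^ (-((D : ℂ) / 2 + (u + (Δ₂ - Δ₁) / 2))) = p₂ at *
  generalize b₂ ^ (- -((D : ℂ) / 2 + (u + (Δ₂ - Δ₁) / 2))) = q₂ at *
  have e₅ : p₂ * p₁ * (q₁ * q₂) = 1 := by
    calc _ = (p₁ * q₁) * (p₂ * q₂) := by ring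
      _ = 1 := by rw [e₃, e₄, one_mul]
  generalize f (act g⁻¹ y.1) (act g⁻¹ y.2) = F
  generalize (a₁ ^ D)⁻¹ = A₁
  generalize (a₂ ^ D)⁻¹ = A₂
  generalize a₁ ^ (- -((D : ℂ) / 2 + (u + (Δ₂ - Δ₁) / 2))) = B₁
  generalize a₂ ^ (- -((D : ℂ) / 2 + (u + (Δ₁ - Δ₂) / 2))) = B₂
  generalize a₁ ^ (-(u + (Δ₁ + Δ₂ - (D : ℂ)) / 2)) = C₁
  generalize a₂ ^ (-(u + (Δ₁ + Δ₂ - (D : ℂ)) / 2)) = C₂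
  generalize ((‖x₂ - y.1‖ : ℝ) : ℂ) ^ (2 * -((D : ℂ) / 2 + (u + (Δ₂ - Δ₁) / 2))) = X
  generalize ((‖x₁ - y.2‖ : ℝ) : ℂ) ^ (2 * -((D : ℂ) / 2 + (u + (Δ₁ - Δ₂) / 2))) = Y
  generalize ((‖y.1 - y.2‖ : ℝ) : ℂ) ^ (2 * (u + (Δ₁ + Δ₂ - (D : ℂ)) / 2)) = Z
  linear_combination (-(A₁ * A₂ * B₁ * B₂ * C₁ * C₂ * X * Y * Z * F)) * e₅

/-- Power counting at the external points: the factors of `Ω` left over from the two kernels,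
combined with the leftmost power of `q₁₂`, give exactly the weights `-Δ₁` and `-Δ₂`. -/
lemma cpow_norm_sub_prefactor {D : ℕ} (Δ₁ Δ₂ u : ℂ) {g : GL (Fin D ⊕ Fin 2) ℝ}
    (hg : g ∈ conformalGroup D) {x₁ x₂ : Space D} (hx₁ : factor g x₁ ≠ 0) (hx₂ : factor g x₂ ≠ 0) :
    ((‖x₁ - x₂‖ : ℝ) : ℂ) ^ (2 * (u + ((D : ℂ) - Δ₁ - Δ₂) / 2)) *
      (((|factor g x₂| : ℝ) : ℂ) ^ (-((D : ℂ) / 2 + (u + (Δ₂ - Δ₁) / 2))) *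
        ((|factor g x₁| : ℝ) : ℂ) ^ (-((D : ℂ) / 2 + (u + (Δ₁ - Δ₂) / 2)))) =
    ((|factor g x₁| : ℝ) : ℂ) ^ (-Δ₁) * ((|factor g x₂| : ℝ) : ℂ) ^ (-Δ₂) *
      ((‖act g x₁ - act g x₂‖ : ℝ) : ℂ) ^ (2 * (u + ((D : ℂ) - Δ₁ - Δ₂) / 2)) := by
  rw [cpow_norm_act_sub hg hx₁ hx₂]
  have hb₁ : ((|factor g x₁| : ℝ) : ℂ) ≠ 0 := by simpa using hx₁
  have hb₂ : ((|factor g x₂| : ℝ) : ℂ) ≠ 0 := by simpa using hx₂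
  generalize ((|factor g x₁| : ℝ) : ℂ) = b₁ at *
  generalize ((|factor g x₂| : ℝ) : ℂ) = b₂ at *
  have e₁ : b₁ ^ (-((D : ℂ) / 2 + (u + (Δ₁ - Δ₂) / 2))) =
      b₁ ^ (-Δ₁) * b₁ ^ (-(u + ((D : ℂ) - Δ₁ - Δ₂) / 2)) := by
    rw [← Complex.cpow_add _ _ hb₁]
    congr 1
    ring
  have e₂ : b₂ ^ (-((D : ℂ) / 2 + (u + (Δ₂ - Δ₁) / 2))) =
      b₂ ^ (-Δ₂) * b₂ ^ (-(u + ((D : ℂ) - Δ₁ - Δ₂) / 2)) := by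
    rw [← Complex.cpow_add _ _ hb₂]
    congr 1
    ring
  rw [e₁, e₂]
  ring

/-- Conformal covariance of `R` in the region where it is an integral operator. -/
theorem converges_and_ROp_rho {D : ℕ} [NeZero D] {Δ₁ Δ₂ u : ℂ} (hs : (u + (Δ₂ - Δ₁) / 2).re < 0)
    (ht : (u + (Δ₁ - Δ₂) / 2).re < 0) {g : GL (Fin D ⊕ Fin 2) ℝ} (hg : g ∈ conformalGroup D)
    {f : Space D → Space D → ℂ} {x₁ x₂ : Space D}
    (hx₁ : factor g⁻¹ x₁ ≠ 0) (hx₂ : factor g⁻¹ x₂ ≠ 0)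
    (hf : Converges Δ₁ Δ₂ u f (act g⁻¹ x₁) (act g⁻¹ x₂)) :
    Converges Δ₁ Δ₂ u (rho Δ₁ Δ₂ g f) x₁ x₂ ∧
      ROp Δ₁ Δ₂ u (rho Δ₁ Δ₂ g f) x₁ x₂ = rho Δ₁ Δ₂ g (ROp Δ₁ Δ₂ u f) x₁ x₂ := by
  have hg' := (conformalGroup D).inv_mem hg
  obtain ⟨hi, hint⟩ := integrable_and_integral_comp_act hg'
    (integrandR Δ₁ Δ₂ u f (act g⁻¹ x₁) (act g⁻¹ x₂))
  have hae := (ae_mem_regularPairs hg').mono fun y hy =>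
    integrandR_rho Δ₁ Δ₂ u hg f hx₁ hx₂ hy
  have hconv : Converges Δ₁ Δ₂ u (rho Δ₁ Δ₂ g f) x₁ x₂ :=
    ((hi.1 hf).const_mul _).congr (hae.mono fun y hy => hy.symm)
  refine ⟨hconv, ?_⟩
  rw [ROp_eq_integral hs ht hconv, rho, ROp_eq_integral hs ht hf, hint, integral_congr_ae hae,
    integral_const_mul]
  linear_combination (aCoeff D (-(u + (Δ₁ - Δ₂) / 2)) * aCoeff D (-(u + (Δ₂ - Δ₁) / 2)) *
    ∫ p : Space D × Space D, ((|factor g⁻¹ p.1| ^ D)⁻¹ * (|factor g⁻¹ p.2| ^ D)⁻¹) •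
      integrandR Δ₁ Δ₂ u f (act g⁻¹ x₁) (act g⁻¹ x₂) (act g⁻¹ p.1, act g⁻¹ p.2)) *
    cpow_norm_sub_prefactor Δ₁ Δ₂ u hg' hx₁ hx₂

lemma IsTest.converges {D : ℕ} [NeZero D] {f : Space D → Space D → ℂ} (hf : IsTest f)
    {Δ₁ Δ₂ u : ℂ} (hs : (u + (Δ₂ - Δ₁) / 2).re < 0) (ht : (u + (Δ₁ - Δ₂) / 2).re < 0)
    (x₁ x₂ : Space D) : Converges Δ₁ Δ₂ u f x₁ x₂ := by
  have hF := hf.isSmoothFamily_q12Pow ((Δ₁ + Δ₂ - (D : ℂ)) / 2)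
  obtain ⟨N₁, hN₁⟩ := exists_kern_integrable false (D := D) (s := u + (Δ₂ - Δ₁) / 2) hs x₂
  obtain ⟨N₂, hN₂⟩ := exists_kern_integrable false (D := D) (s := u + (Δ₁ - Δ₂) / 2) ht x₁
  obtain ⟨C, hC0, hC⟩ := hF.exists_norm_le hf.compact (max N₁ N₂) ‖u‖
  refine (((hN₁ (max N₁ N₂) (le_max_left _ _)).mul_prod (hN₂ (max N₁ N₂) (le_max_right _ _))).const_mul C).mono' ?_
    (Eventually.of_forall fun p => ?_)
  · refine AEStronglyMeasurable.mul (Measurable.aestronglyMeasurable (by fun_prop)) ?_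
    exact (hF.stronglyMeasurable u).aestronglyMeasurable
  · rw [norm_mul, norm_mul]
    refine (mul_le_mul_of_nonneg_left (hC u le_rfl p.1 p.2) (by positivity)).trans_eq ?_
    simp only [kern, cond_false]
    ring

/-- By covariance the sum is one integral against `∑ ρ(gᵢ) fᵢ`, which vanishes at almost every pair.
-/
theorem sum_rho_ROp_eq_zero_of_re_neg {D : ℕ} [NeZero D] {Δ₁ Δ₂ u : ℂ}
    (hs : (u + (Δ₂ - Δ₁) / 2).re < 0) (ht : (u + (Δ₁ - Δ₂) / 2).re < 0) {n : ℕ}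
    {g : Fin n → GL (Fin D ⊕ Fin 2) ℝ} {f : Fin n → Space D → Space D → ℂ}
    (hg : ∀ i, g i ∈ conformalGroup D) (hf : ∀ i, IsTest (f i))
    (h0 : ∀ x₁ x₂ : Space D, (∀ i, factor (g i)⁻¹ x₁ ≠ 0 ∧ factor (g i)⁻¹ x₂ ≠ 0) →
      ∑ i, rho Δ₁ Δ₂ (g i) (f i) x₁ x₂ = 0) {x₁ x₂ : Space D}
    (hx : ∀ i, factor (g i)⁻¹ x₁ ≠ 0 ∧ factor (g i)⁻¹ x₂ ≠ 0) :
    ∑ i, rho Δ₁ Δ₂ (g i) (ROp Δ₁ Δ₂ u (f i)) x₁ x₂ = 0 := by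
  have h := fun i => converges_and_ROp_rho hs ht (hg i) (hx i).1 (hx i).2
    ((hf i).converges hs ht (act (g i)⁻¹ x₁) (act (g i)⁻¹ x₂))
  have hsum : ∫ y, ∑ i, integrandR Δ₁ Δ₂ u (rho Δ₁ Δ₂ (g i) (f i)) x₁ x₂ y = 0 := by
    refine integral_eq_zero_of_ae ?_
    filter_upwards [eventually_all.2 fun i =>
      ae_mem_regularPairs ((conformalGroup D).inv_mem (hg i))] with y hy
    simp only [integrandR, ← Finset.mul_sum]
    rw [h0 y.1 y.2 fun i => hy i]
    simp
  simp only [← (h _).2, ROp_eq_integral hs ht (h _).1, ← Finset.mul_sum]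
  rw [← integral_finsetSum (f := fun i => integrandR Δ₁ Δ₂ u (rho Δ₁ Δ₂ (g i) (f i)) x₁ x₂) _
    fun i _ => (h i).1, hsum]
  simp

/-! ### Analytic continuation in `u` -/

/-- The spectral parameters at which both powers of the momenta exist. -/
def regularParameters (D : ℕ) (c c' : ℂ) : Set ℂ :=
  {u | (∀ n : ℕ, u + c ≠ -((D : ℂ) / 2 + n)) ∧ ∀ n : ℕ, u + c' ≠ -((D : ℂ) / 2 + n)}

/-- The excluded values are the zeros of the entire functions `1/Γ(D/2 + u + c)` and `1/Γ(D/2 + u +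
c')`. -/
lemma isOpen_regularParameters (D : ℕ) (c c' : ℂ) : IsOpen (regularParameters D c c') := by
  have h : ∀ c : ℂ, IsOpen {u : ℂ | ∀ n : ℕ, u + c ≠ -((D : ℂ) / 2 + n)} := by
    intro c
    have hc : Continuous fun u : ℂ => (Complex.Gamma ((D : ℂ) / 2 + (u + c)))⁻¹ :=
      Complex.differentiable_one_div_Gamma.continuous.comp (by fun_prop)
    convert isOpen_ne_fun hc continuous_const (g := fun _ => (0 : ℂ)) using 1
    ext u
    simp only [Set.mem_ofPred_eq, ne_eq, inv_eq_zero, Complex.Gamma_eq_zero_iff, not_exists]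
    refine forall_congr' fun n => not_congr ⟨fun h => ?_, fun h => ?_⟩
    · rw [h]; ring
    · linear_combination h
  exact (h c).inter (h c')

/-- The complement of a countable set in a real vector space of dimension greater than one is
connected. -/
lemma isPreconnected_regularParameters (D : ℕ) (c c' : ℂ) :
    IsPreconnected (regularParameters D c c') := by
  have hc : (Set.range (fun n : ℕ => -((D : ℂ) / 2 + n) - c) ∪
      Set.range (fun n : ℕ => -((D : ℂ) / 2 + n) - c')).Countable :=
    (Set.countable_range _).union (Set.countable_range _)
  convert! (hc.isConnected_compl_of_one_lt_rank (E := ℂ) (by simp)).isPreconnected using 1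
  ext u
  simp only [regularParameters, Set.mem_ofPred_eq, Set.mem_compl_iff, Set.mem_union, Set.mem_range,
    not_or, not_exists, ne_eq, eq_comm]
  simp only [eq_sub_iff_add_eq]

/-- Identity theorem: the sum is holomorphic in `u` on the regular parameters and vanishes on an
open set of them, where both exponents have negative real part. The points `gᵢ⁻¹ x₁`, `gᵢ⁻¹ x₂` stay
distinct, as holomorphy of the outer `q₁₂` power requires. -/
theorem sum_rho_ROp_eq_zero {D : ℕ} [NeZero D] {Δ₁ Δ₂ u : ℂ}
    (hs : ∀ n : ℕ, u + (Δ₂ - Δ₁) / 2 ≠ -((D : ℂ) / 2 + n))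
    (ht : ∀ n : ℕ, u + (Δ₁ - Δ₂) / 2 ≠ -((D : ℂ) / 2 + n)) {n : ℕ}
    {g : Fin n → GL (Fin D ⊕ Fin 2) ℝ} {f : Fin n → Space D → Space D → ℂ}
    (hg : ∀ i, g i ∈ conformalGroup D) (hf : ∀ i, IsTest (f i))
    (h0 : ∀ x₁ x₂ : Space D, (∀ i, factor (g i)⁻¹ x₁ ≠ 0 ∧ factor (g i)⁻¹ x₂ ≠ 0) →
      ∑ i, rho Δ₁ Δ₂ (g i) (f i) x₁ x₂ = 0) {x₁ x₂ : Space D} (hne : x₁ ≠ x₂)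
    (hx : ∀ i, factor (g i)⁻¹ x₁ ≠ 0 ∧ factor (g i)⁻¹ x₂ ≠ 0) :
    ∑ i, rho Δ₁ Δ₂ (g i) (ROp Δ₁ Δ₂ u (f i)) x₁ x₂ = 0 := by
  set U := regularParameters D ((Δ₂ - Δ₁) / 2) ((Δ₁ - Δ₂) / 2) with hU
  have hdiff : DifferentiableOn ℂ
      (fun u => ∑ i, rho Δ₁ Δ₂ (g i) (ROp Δ₁ Δ₂ u (f i)) x₁ x₂) U := by
    intro v hv
    refine DifferentiableAt.differentiableWithinAt (DifferentiableAt.fun_sum fun i _ => ?_)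
    exact ((hf i).differentiableAt_ROp Δ₁ Δ₂ hv.1 hv.2 (act_ne_act ((conformalGroup D).inv_mem (hg i))
      (hx i).1 (hx i).2 hne)).const_mul _
  set d := (Δ₂ - Δ₁) / 2 with hd
  have hd' : (Δ₁ - Δ₂) / 2 = -d := by rw [hd]; ring
  -- The real part makes `Re (u₀ ± d) < 0`; the imaginary part makes `u₀ ± d` nonreal, hence
  -- different from the excluded values, which are real.
  set u₀ : ℂ := ⟨-(|d.re| + 1), |d.im| + 1⟩ with hu₀
  have hre : u₀.re = -(|d.re| + 1) := rfl
  have him : u₀.im = |d.im| + 1 := rfl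
  have h1 := neg_abs_le d.re
  have h2 := le_abs_self d.re
  have h3 := neg_abs_le d.im
  have h4 := le_abs_self d.im
  have hmem : u₀ ∈ U := by
    refine ⟨fun n h => ?_, fun n h => ?_⟩
    · rw [← hd] at h
      have := congrArg Complex.im h
      simp [him] at this
      linarith
    · rw [hd'] at h
      have := congrArg Complex.im h
      simp [him] at this
      linarith
  have hev : (fun u => ∑ i, rho Δ₁ Δ₂ (g i) (ROp Δ₁ Δ₂ u (f i)) x₁ x₂) =ᶠ[𝓝 u₀] 0 := by
    have o1 : ∀ᶠ u : ℂ in 𝓝 u₀, (u + d).re < 0 := by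
      refine (Complex.continuous_re.comp (continuous_add_const d)).continuousAt.eventually_lt
        continuousAt_const ?_
      simp only [Function.comp_apply, Complex.add_re, hre]
      linarith
    have o2 : ∀ᶠ u : ℂ in 𝓝 u₀, (u + (Δ₁ - Δ₂) / 2).re < 0 := by
      refine (Complex.continuous_re.comp (continuous_add_const _)).continuousAt.eventually_lt
        continuousAt_const ?_
      simp only [Function.comp_apply, hd', Complex.add_re, Complex.neg_re, hre]
      linarith
    filter_upwards [o1, o2] with v hv1 hv2
    exact sum_rho_ROp_eq_zero_of_re_neg hv1 hv2 hg hf h0 hx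
  exact (hdiff.analyticOnNhd (isOpen_regularParameters _ _ _)).eqOn_zero_of_preconnected_of_eventuallyEq_zero
    (isPreconnected_regularParameters _ _ _) hmem hev ⟨hs, ht⟩

/-- Negation passes through integrals with no integrability condition, unlike addition; it is the
only linearity of `R` that the two-term relation needs. -/
lemma pPow_neg {D : ℕ} (s : ℂ) (h : Space D → ℂ) (x : Space D) :
    pPow s (fun y => -h y) x = -pPow s h x := by
  have hF : 𝓕 (fun y => -h y) = fun ξ => -𝓕 h ξ := by
    ext ξ
    simp only [Real.fourier_eq, smul_neg, integral_neg]
  simp only [pPow, hF, Real.fourierInv_eq, mul_neg, smul_neg, integral_neg]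
  split_ifs <;> rfl

lemma ROp_neg {D : ℕ} (Δ₁ Δ₂ u : ℂ) (f : Space D → Space D → ℂ) (x₁ x₂ : Space D) :
    ROp Δ₁ Δ₂ u (fun y₁ y₂ => -f y₁ y₂) x₁ x₂ = -ROp Δ₁ Δ₂ u f x₁ x₂ := by
  simp only [ROp, perm, q12Pow, p2Pow, p1Pow, mul_neg, pPow_neg]

lemma IsTest.neg {D : ℕ} {f : Space D → Space D → ℂ} (hf : IsTest f) :
    IsTest fun y₁ y₂ => -f y₁ y₂ where
  smooth := hf.smooth.neg
  compact := hf.compact.neg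
  off_diag z hz := hf.off_diag z (by
    have : (fun z : Space D × Space D => -f z.1 z.2) = -fun z : Space D × Space D => f z.1 z.2 := rfl
    rwa [this, tsupport, Function.support_neg] at hz)

lemma factor_one {D : ℕ} (x : Space D) : factor 1 x = 1 := by
  simp [factor, lift_sum]

lemma rho_one {D : ℕ} (Δ₁ Δ₂ : ℂ) (f : Space D → Space D → ℂ) : rho Δ₁ Δ₂ 1 f = f := by
  have h : ∀ x : Space D, act 1 x = x := fun x => act_eq_of_mulVec one_ne_zero (by simp)
  ext x₁ x₂
  simp [rho, factor_one, h]

end ConformalR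

open ConformalR in
theorem proposition7 (D : ℕ) (hD : 1 ≤ D) (Δ₁ Δ₂ u : ℂ)
    (hs : ∀ n : ℕ, u + (Δ₂ - Δ₁) / 2 ≠ -((D : ℂ) / 2 + n))
    (ht : ∀ n : ℕ, u + (Δ₁ - Δ₂) / 2 ≠ -((D : ℂ) / 2 + n)) :
    -- `R ρ(g) f = ρ(g) R f` whenever `f` and `ρ(g) f` are test functions
    (∀ g ∈ conformalGroup D, ∀ f f' : Space D → Space D → ℂ, IsTest f → IsTest f' →
      (∀ x₁ x₂ : Space D, factor g⁻¹ x₁ ≠ 0 → factor g⁻¹ x₂ ≠ 0 →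
        f' x₁ x₂ = rho Δ₁ Δ₂ g f x₁ x₂) →
      ∀ x₁ x₂ : Space D, x₁ ≠ x₂ → factor g⁻¹ x₁ ≠ 0 → factor g⁻¹ x₂ ≠ 0 →
        ROp Δ₁ Δ₂ u f' x₁ x₂ = rho Δ₁ Δ₂ g (ROp Δ₁ Δ₂ u f) x₁ x₂) ∧
    -- `∑ ρ(gᵢ) fᵢ ↦ ∑ ρ(gᵢ) R fᵢ` is well defined, so that `R` extends to an operator commuting
    -- with the whole group on the invariant space spanned by all `ρ(g) f` with `f` a test function
    (∀ (n : ℕ) (g : Fin n → GL (Fin D ⊕ Fin 2) ℝ) (f : Fin n → Space D → Space D → ℂ),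
      (∀ i, g i ∈ conformalGroup D) → (∀ i, IsTest (f i)) →
      (∀ x₁ x₂ : Space D, (∀ i, factor (g i)⁻¹ x₁ ≠ 0 ∧ factor (g i)⁻¹ x₂ ≠ 0) →
        ∑ i, rho Δ₁ Δ₂ (g i) (f i) x₁ x₂ = 0) →
      ∀ x₁ x₂ : Space D, x₁ ≠ x₂ → (∀ i, factor (g i)⁻¹ x₁ ≠ 0 ∧ factor (g i)⁻¹ x₂ ≠ 0) →
        ∑ i, rho Δ₁ Δ₂ (g i) (ROp Δ₁ Δ₂ u (f i)) x₁ x₂ = 0) ∧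
    -- where `R` is an integral operator, it commutes with `ρ(g)` on all functions for which the
    -- integral converges absolutely
    ((u + (Δ₂ - Δ₁) / 2).re < 0 → (u + (Δ₁ - Δ₂) / 2).re < 0 →
      ∀ g ∈ conformalGroup D, ∀ (f : Space D → Space D → ℂ) (x₁ x₂ : Space D), x₁ ≠ x₂ →
        factor g⁻¹ x₁ ≠ 0 → factor g⁻¹ x₂ ≠ 0 →
        Converges Δ₁ Δ₂ u f (act g⁻¹ x₁) (act g⁻¹ x₂) →
        Converges Δ₁ Δ₂ u (rho Δ₁ Δ₂ g f) x₁ x₂ ∧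
        ROp Δ₁ Δ₂ u (rho Δ₁ Δ₂ g f) x₁ x₂ = rho Δ₁ Δ₂ g (ROp Δ₁ Δ₂ u f) x₁ x₂) := by
  have : NeZero D := ⟨by omega⟩
  refine ⟨fun g hg f f' hf hf' hff' x₁ x₂ hne hx₁ hx₂ => ?_,
    fun n g f hg hf h0 x₁ x₂ hne hx => sum_rho_ROp_eq_zero hs ht hg hf h0 hne hx,
    fun hs' ht' g hg f x₁ x₂ _ hx₁ hx₂ hf => converges_and_ROp_rho hs' ht' hg hx₁ hx₂ hf⟩
  -- The hypothesis on `f'` is read as the two-term relation `ρ(g) f + ρ(1)(-f') = 0`.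
  have h := sum_rho_ROp_eq_zero hs ht (n := 2) (g := ![g, 1]) (f := ![f, fun y₁ y₂ => -f' y₁ y₂])
    (x₁ := x₁) (x₂ := x₂) ?_ ?_ ?_ hne ?_
  · simp only [Fin.sum_univ_two, Matrix.cons_val_zero, Matrix.cons_val_one, rho_one, ROp_neg] at h
    linear_combination -h
  · simp [Fin.forall_fin_two, hg]
  · simp [Fin.forall_fin_two, hf, hf'.neg]
  · intro y₁ y₂ hy
    have hy0 := hy 0
    simp only [Matrix.cons_val_zero] at hy0
    simp [Fin.sum_univ_two, rho_one, hff' y₁ y₂ hy0.1 hy0.2]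
  · simp [Fin.forall_fin_two, hx₁, hx₂, factor_one]
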